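/- Let $q$ be a prime power and, for integers $n\ge 1$ and $m\ge 0$, let $\mathcal Q_m(n)=\mathbb F_q[x_1,\dots,x_n]/(x_1^{q^m},\dots,x_n^{q^m})$. The group $\mathrm{GL}_n(\mathbb F_q)$ acts on it by linear substitutions $\sigma x_j=\sum_i\sigma_{ij}x_i$; let $\mathrm B_n\subseteq \mathrm{GL}_n(\mathbb F_q)$ be the Borel subgroup of upper triangular matrices and $\mathcal Q_m(n)^{\mathrm B_n}$ the $\mathbb F_q$-subspace of $\mathrm B_n$-invariants. For integers $a\ge 1$, $b,c\ge 0$ with $a\le c+1$ and a rational function $f\in\mathbb F_q(x_1,\dots,x_c)$ let $$\delta_{a;b}(f)=\frac{\det N}{\det\big(x_j^{q^{i-1}}\big)_{1\le i,j\le a}}\in\mathbb F_q(x_1,\dots,x_{c+1}),$$ where $N$ is the $a\times a$ matrix with entries $N_{ij}=x_j^{q^{i-1}}$ for $i<a$ and $N_{aj}=x_j^{q^b}f(x_1,\dots,\widehat{x_j},\dots,x_{c+1})$ (the hat means that $x_j$ is omitted). Put $D_a=\delta_{a;a}(1)$ and $[a]_q=(q^a-1)/(q-1)$. For $k\ge 1$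 and sequences $I=(i_1,\dots,i_k)$, $J=(j_1,\dots,j_k)$ of non-negative integers put $$Y_b(I;J)=\delta_{1;b}^{i_1}\Big(D_1^{j_1}\,\delta_{2;b}^{i_2}\big(D_2^{j_2}(\cdots\delta_{k;b}^{i_k}(D_k^{j_k})\cdots)\big)\Big),$$ where $D_k^{j_k}$ is regarded as a function of $x_1,\dots,x_k$, so that $Y_b(I;J)$ is a rational function of $x_1,\dots,x_{k+i_1+\cdots+i_k}$. Define the operator $\Phi$ on such expressions by $\Phi\,Y_b(I;J)=Y_{b+1}(0,I;0,J)$. Define sets $\mathcal B_m(n)$ of expressions $Y_m(I;J)$ inductively by $$\mathcal B_0(n)=\{1\}\quad(n\ge 1),\qquad \mathcal B_m(1)=\{D_1^a\mid 0\le a\le [m]_q\}\quad(m\ge 0),$$ $$\mathcal B_m(n)=\{\delta_{1;m}(Y)\mid Y\in\mathcal B_m(n-1)\}\ \sqcup\ \{D_1^a\,\Phi(Y)\mid 0\le a<[m]_q,\ Y\in\mathcal B_{m-1}(n-1)\}\quad(n\ge 2,\ m\ge 1),$$ where $1\in\mathcal B_0(n)$ is written as $Y_0(n-1;0)$, $D_1^a\in\mathcal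 B_m(1)$ as $Y_m(0;a)$, $\delta_{1;m}Y_m(I;J)$ as $Y_m(i_1+1,i_2,\dots,i_k;J)$ and $D_1^a\,\Phi Y_{m-1}(I;J)$ as $Y_m(0,I;a,J)$. Theorem. For all $n\ge 1$ and $m\ge 0$, distinct expressions in $\mathcal B_m(n)$ are distinct as rational functions (in particular the above unions are disjoint), every element of $\mathcal B_m(n)$ is a polynomial in $\mathbb F_q[x_1,\dots,x_n]$, and the residue classes of the elements of $\mathcal B_m(n)$ form an $\mathbb F_q$-basis of $\mathcal Q_m(n)^{\mathrm B_n}$. -/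

import Mathlib

/-!
Throughout, `K` is a finite field and `q = Fintype.card K`, so that `K` is `𝔽_q`.  The variables
`x_1, x_2, …` are indexed from `0` in the code: `x_{i+1}` is the variable with index `i`.
-/

noncomputable section

namespace Borel

open MvPolynomial

/-! ### Rational functions and the operators `δ_{a;b}` -/

/-- The field `𝔽_q(x_1, x_2, …)`.  It contains `𝔽_q(x_1, …, x_c)` for every `c`, and all rational
functions below are regarded as elements of it. -/
abbrev RatField (K : Type*) [Field K] : Type _ := FractionRing (MvPolynomial ℕ K)

section Operators

variable (K : Type*) [Field K] [Fintype K]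

/-- The variable `x_{i+1}` as a rational function. -/
def x (i : ℕ) : RatField K := algebraMap (MvPolynomial ℕ K) (RatField K) (X i)

/-- The increasing map `ℕ → ℕ` whose image misses exactly `j`. -/
def skip (j i : ℕ) : ℕ := if i < j then i else i + 1

theorem skip_injective (j : ℕ) : Function.Injective (skip j) := by
  intro a b h
  unfold skip at h
  split_ifs at h <;> omega

/-- The field homomorphism `f(x_1, …, x_c) ↦ f(x_1, …, x̂_{j+1}, …, x_{c+1})`: the
arguments of `f` are the variables other than `x_{j+1}`, in their natural order.  (It does not
depend on `c`.) -/
def omitVar (j : ℕ) : RatField K →+* RatField K :=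
  IsFractionRing.map (A := MvPolynomial ℕ K) (B := MvPolynomial ℕ K)
    (j := (rename (skip j) : MvPolynomial ℕ K →ₐ[K] MvPolynomial ℕ K).toRingHom)
    (rename_injective _ (skip_injective j))

/-- The Moore matrix `(x_j^{q^{i-1}})_{1 ≤ i, j ≤ a}`. -/
def mooreMatrix (a : ℕ) : Matrix (Fin a) (Fin a) (RatField K) :=
  Matrix.of fun i j => x K j ^ Fintype.card K ^ (i : ℕ)

/-- The matrix in the numerator of `δ_{a;b}(f)`: its first `a - 1` rows are those of the Moore
matrix, and its last row is `(x_j^{q^b} f(x_1, …, x̂_j, …, x_{c+1}))_{1 ≤ j ≤ a}`. -/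
def deltaMatrix (a b : ℕ) (f : RatField K) : Matrix (Fin a) (Fin a) (RatField K) :=
  Matrix.of fun i j =>
    if (i : ℕ) + 1 = a then x K j ^ Fintype.card K ^ b * omitVar K j f
    else x K j ^ Fintype.card K ^ (i : ℕ)

/-- The operator `δ_{a;b}`. -/
def delta (a b : ℕ) (f : RatField K) : RatField K := (deltaMatrix K a b f).det / (mooreMatrix K a).det

/-- `D_a = δ_{a;a}(1)`. -/
def D (a : ℕ) : RatField K := delta K a a 1

/-- For `w = [(i_1, j_1), …, (i_k, j_k)]`, the iterated expression starting at rank `a`,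
`δ_{a;b}^{i_1}(D_a^{j_1} δ_{a+1;b}^{i_2}(D_{a+1}^{j_2}( ⋯ δ_{a+k-1;b}^{i_k}(D_{a+k-1}^{j_k}))))`. -/
def Yfrom (b : ℕ) : ℕ → List (ℕ × ℕ) → RatField K
  | _, [] => 1
  | a, (i, j) :: w => (delta K a b)^[i] (D K a ^ j * Yfrom b (a + 1) w)

/-- `Y_b(I; J)`, where the two sequences `I = (i_1, …, i_k)` and `J = (j_1, …, j_k)` are
recorded as the one list `[(i_1, j_1), …, (i_k, j_k)]`. -/
def Y (b : ℕ) (w : List (ℕ × ℕ)) : RatField K := Yfrom K b 1 w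

/-- `Φ Y_b(I; J) = Y_{b+1}(0, I; 0, J)`; a function of the pair of sequences. -/
def PhiY (b : ℕ) (w : List (ℕ × ℕ)) : RatField K := Y K (b + 1) ((0, 0) :: w)

end Operators

/-! ### The set `𝓑_m(n)` -/

theorem x_ne_zero (K : Type*) [Field K] (i : ℕ) : x K i ≠ 0 := by
  unfold x
  rw [Ne, FaithfulSMul.algebraMap_eq_zero_iff]
  exact X_ne_zero i

/-- The `q`-integer `[a]_q = 1 + q + ⋯ + q^{a-1}`. -/
def qInt (q a : ℕ) : ℕ := ∑ i ∈ Finset.range a, q ^ i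

theorem qInt_eq (q a : ℕ) (hq : 2 ≤ q) : qInt q a = (q ^ a - 1) / (q - 1) :=
  Nat.geomSum_eq hq a

/-- `(i_1, …, i_k; J) ↦ (i_1 + 1, i_2, …, i_k; J)`. -/
def incHead : List (ℕ × ℕ) → List (ℕ × ℕ)
  | [] => []
  | (i, j) :: w => (i + 1, j) :: w

/-- The pairs of sequences `(I; J)` such that the elements of `𝓑_m(n)` are the `Y_m(I; J)`.
The theorems `basisSet_zero`, `basisSet_one` and `basisSet_rec` give the resulting inductive
description of `𝓑_m(n)` itself. The value at `n = 0` is irrelevant. -/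
def words (q : ℕ) : ℕ → ℕ → Set (List (ℕ × ℕ))
  | _, 0 => ∅
  | 0, n + 1 => {[(n, 0)]}
  | m + 1, 1 => {w | ∃ a ≤ qInt q (m + 1), w = [(0, a)]}
  | m + 1, n + 2 =>
      {w | ∃ v ∈ words q (m + 1) (n + 1), w = incHead v} ∪
      {w | ∃ a < qInt q (m + 1), ∃ v ∈ words q m (n + 1), w = (0, a) :: v}

variable (K : Type*) [Field K] [Fintype K]

/-- The set `𝓑_m(n)` of rational functions. -/
def basisSet (m n : ℕ) : Set (RatField K) := Y K m '' words (Fintype.card K) m n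

/-- `𝓑_0(n) = {1}` for all `n ≥ 1`. -/
theorem basisSet_zero (n : ℕ) : basisSet K 0 (n + 1) = {1} := by
  have h : ∀ k : ℕ, (delta K 1 0)^[k] 1 = 1 := by
    intro k
    induction k with
    | zero => rfl
    | succ k ih =>
      rw [Function.iterate_succ_apply', ih]
      simp [delta, deltaMatrix, mooreMatrix, x_ne_zero]
  simp [basisSet, words, Y, Yfrom, h]

/-- `𝓑_m(1) = {D_1^a | a ≤ [m]_q}` for all `m ≥ 0`. -/
theorem basisSet_one (m : ℕ) :
    basisSet K m 1 = {f | ∃ a ≤ qInt (Fintype.card K) m, f = D K 1 ^ a} := by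
  cases m with
  | zero => rw [basisSet_zero]; ext f; simp [qInt]
  | succ m =>
    ext f
    constructor
    · rintro ⟨w, ⟨a, ha, rfl⟩, rfl⟩
      exact ⟨a, ha, by simp [Y, Yfrom]⟩
    · rintro ⟨a, ha, rfl⟩
      exact ⟨_, ⟨a, ha, rfl⟩, by simp [Y, Yfrom]⟩

theorem words_ne_nil (q m n : ℕ) : ∀ w ∈ words q m n, w ≠ [] := by
  induction n with
  | zero => simp [words]
  | succ n ih =>
    intro w hw
    match m, n, ih, hw with
    | 0, n, _, hw =>
      have : w = [(n, 0)] := by simpa [words] using hw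
      simp [this]
    | m + 1, 0, _, hw => obtain ⟨a, -, rfl⟩ := hw; simp
    | m + 1, n + 1, ih, hw =>
      rcases hw with ⟨v, hv, rfl⟩ | ⟨a, -, v, -, rfl⟩
      · have := ih v hv
        cases v with
        | nil => exact absurd rfl this
        | cons p v => simp [incHead]
      · simp

/-- `𝓑_m(n) = {δ_{1;m}(Y) | Y ∈ 𝓑_m(n-1)} ∪ {D_1^a Φ(Y) | a < [m]_q, Y ∈ 𝓑_{m-1}(n-1)}` for all
`n ≥ 2` and `m ≥ 1`. -/
theorem basisSet_rec (m n : ℕ) :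
    basisSet K (m + 1) (n + 2) =
      delta K 1 (m + 1) '' basisSet K (m + 1) (n + 1) ∪
      {f | ∃ a < qInt (Fintype.card K) (m + 1), ∃ w ∈ words (Fintype.card K) m (n + 1),
        f = D K 1 ^ a * PhiY K m w} := by
  have h1 : ∀ w ∈ words (Fintype.card K) (m + 1) (n + 1),
      Y K (m + 1) (incHead w) = delta K 1 (m + 1) (Y K (m + 1) w) := by
    intro w hw
    have := words_ne_nil _ _ _ w hw
    match w, this with
    | (i, j) :: w, _ => simp only [incHead, Y, Yfrom, Function.iterate_succ_apply']
  have h2 : ∀ a w, Y K (m + 1) ((0, a) :: w) = D K 1 ^ a * PhiY K m w := by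
    intro a w
    simp [PhiY, Y, Yfrom]
  ext f
  constructor
  · rintro ⟨w, ⟨v, hv, rfl⟩ | ⟨a, ha, v, hv, rfl⟩, rfl⟩
    · exact Or.inl ⟨_, ⟨v, hv, rfl⟩, (h1 v hv).symm⟩
    · exact Or.inr ⟨a, ha, v, hv, h2 a v⟩
  · rintro (⟨_, ⟨v, hv, rfl⟩, rfl⟩ | ⟨a, ha, v, hv, rfl⟩)
    · exact ⟨_, Or.inl ⟨v, hv, rfl⟩, h1 v hv⟩
    · exact ⟨_, Or.inr ⟨a, ha, v, hv, rfl⟩, h2 a v⟩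

/-- The inclusion `𝔽_q[x_1, …, x_n] ⊆ 𝔽_q(x_1, x_2, …)`. -/
def toRatField (n : ℕ) : MvPolynomial (Fin n) K →+* RatField K :=
  (algebraMap (MvPolynomial ℕ K) (RatField K)).comp
    (rename (Fin.val : Fin n → ℕ) : MvPolynomial (Fin n) K →ₐ[K] MvPolynomial ℕ K).toRingHom

/-! ### The truncated polynomial algebra and its Borel invariants -/

/-- The ideal `(x_1^{q^m}, …, x_n^{q^m})` of `𝔽_q[x_1, …, x_n]`. -/
def truncIdeal (m n : ℕ) : Ideal (MvPolynomial (Fin n) K) :=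
  Ideal.span (Set.range fun i => X i ^ Fintype.card K ^ m)

/-- The truncated polynomial algebra `𝓠_m(n)`. -/
abbrev Trunc (m n : ℕ) : Type _ := MvPolynomial (Fin n) K ⧸ truncIdeal K m n

/-- The linear substitution `σ x_j = ∑_i σ_{ij} x_i` on `𝔽_q[x_1, …, x_n]`. -/
def linSubst {K : Type*} [Field K] {n : ℕ} (σ : GL (Fin n) K) :
    MvPolynomial (Fin n) K →ₐ[K] MvPolynomial (Fin n) K :=
  aeval fun j => ∑ i, C (σ.1 i j) * X i

theorem linSubst_mem {m n : ℕ} (σ : GL (Fin n) K) (f : MvPolynomial (Fin n) K)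
    (hf : f ∈ truncIdeal K m n) : linSubst σ f ∈ truncIdeal K m n := by
  have hle : truncIdeal K m n ≤ (truncIdeal K m n).comap (linSubst σ).toRingHom := by
    unfold truncIdeal
    rw [Ideal.span_le]
    rintro _ ⟨j, rfl⟩
    obtain ⟨p, hp⟩ := CharP.exists K
    obtain ⟨k, hprime, hk⟩ := FiniteField.card K p
    have : Fact p.Prime := ⟨hprime⟩
    change linSubst σ (X j ^ Fintype.card K ^ m) ∈ truncIdeal K m n
    rw [map_pow, linSubst, aeval_X, hk, ← pow_mul, sum_pow_char_pow]
    refine Ideal.sum_mem _ fun i _ => ?_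
    rw [mul_pow]
    exact Ideal.mul_mem_left _ _ (Ideal.subset_span ⟨i, by simp only [hk, pow_mul]⟩)
  exact hle hf

/-- The induced action of `σ ∈ GL_n(𝔽_q)` on `𝓠_m(n)`. -/
def truncAct (m : ℕ) {n : ℕ} (σ : GL (Fin n) K) : Trunc K m n →ₐ[K] Trunc K m n :=
  Ideal.Quotient.liftₐ (truncIdeal K m n)
    ((Ideal.Quotient.mkₐ K (truncIdeal K m n)).comp (linSubst σ))
    (fun f hf => Ideal.Quotient.eq_zero_iff_mem.mpr (linSubst_mem K σ f hf))

/-- The Borel subgroup `B_n` of upper triangular matrices in `GL_n(𝔽_q)`. -/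
def borelSubgroup (K : Type*) [Field K] (n : ℕ) : Subgroup (GL (Fin n) K) where
  carrier := {σ | ∀ i j : Fin n, j < i → σ.1 i j = 0}
  mul_mem' {σ τ} hσ hτ := by
    have h : Matrix.BlockTriangular (σ.1 * τ.1) id :=
      Matrix.BlockTriangular.mul (b := id) (fun i j h => hσ i j h) (fun i j h => hτ i j h)
    exact fun i j hij => h hij
  one_mem' := fun i j hij => Matrix.one_apply_ne hij.ne'
  inv_mem' {σ} hσ := by
    have h : Matrix.BlockTriangular (σ.1)⁻¹ id := by
      letI := σ.isUnit.invertible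
      exact Matrix.blockTriangular_inv_of_blockTriangular (fun i j h => hσ i j h)
    intro i j hij
    rw [Matrix.coe_units_inv]
    exact h hij

/-- The `𝔽_q`-vector space `𝓠_m(n)^{B_n}` of Borel invariants. -/
def invariants (m n : ℕ) : Submodule K (Trunc K m n) where
  carrier := {F | ∀ σ ∈ borelSubgroup K n, truncAct K m σ F = F}
  add_mem' hF hG σ hσ := by rw [map_add, hF σ hσ, hG σ hσ]
  zero_mem' σ _ := map_zero _
  smul_mem' c F hF σ hσ := by rw [map_smul, hF σ hσ]

end Borel

end

noncomputable section

namespace Borel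

open MvPolynomial

section

/-! ### Minors of a matrix with a kernel vector -/

/-! Variables are indexed from 0, as in the code. The theorem is proved by induction on the number
of variables, filtering polynomials by their order in x_0. Let f be invariant modulo the truncation
ideal. Scaling x_0 shows that, modulo that ideal, only the exponents a(q-1) with 0 ≤ a ≤ [m]_q occur
(`BorelInv.xCoeff_mem`). The substitutions x_j ↦ x_j + x_0 force the leading coefficient, when a <
[m]_q, to be the q-th power of an invariant for m-1 in the remaining variables
(`BorelInv.exists_frob`). In the top degree q^m - 1 = [m]_q(q-1) the coefficient is an invariant for
m.

The two halves of the recursion realise exactly these leading terms: δ_{1;m}(Y) is x_0^{q^m-1} times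
a shift of Y, and D_1^a Φ(Y) starts with x_0^{a(q-1)} times the q-th power of a shift of Y. So bases
for n-1 variables give a basis for n variables (`BasisMod.of_filtration`, `BasisMod.step`).

It remains to see that the expressions are invariant polynomials with these leading terms. The Moore
determinant is, up to a scalar, the product of one linear form for each point of projective space,
so divisibility by it is tested on hyperplanes ∑ v_j x_j = 0 (`mooreDet_dvd`). There the maximal
minors are proportional to the coefficients ±v_j, and polynomiality of δ(f) becomes the identity ∑
v_j x_j^Q f(…, x̂_j, …) = 0 (`DeltaDvd.sum_eq_zero`, `deltaDvd_of_sum_eq_zero`). Evaluated on the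
variables with x_i + c x_k inserted, the same identity gives invariance under x_i ↦ x_i + c x_k
modulo x_k^Q (`DeltaDvd.shear_sub`). The class `Good` records these properties; δ and multiplication
by Dickson invariants preserve it (`Good.isDelta`, `Good.dickson_mul`). The leading term of Φ(Y)
comes from setting x_0 = 0 in δ (`IsDelta.killVar_eq`). -/

theorem minor_proportional {R : Type*} [CommRing R] [IsDomain R] {k : ℕ}
    (A : Matrix (Fin k) (Fin (k + 1)) R) {v : Fin (k + 1) → R} (hv : v ≠ 0)
    (h : A.mulVec v = 0) (j l : Fin (k + 1)) :
    (-1) ^ (j : ℕ) * v l * (A.submatrix id j.succAbove).det =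
      (-1) ^ (l : ℕ) * v j * (A.submatrix id l.succAbove).det := by
  let w : Fin (k + 1) → R := v l • Pi.single j 1 - v j • Pi.single l 1
  let B : Matrix (Fin (k + 1)) (Fin (k + 1)) R := Matrix.of fun i j => Fin.cases (w j) (fun i => A i j) i
  -- `B` is `A` with the row `w` on top. Since `w` is orthogonal to `v`, the vector `v` is in the
  -- kernel of `B`; expanding along `w`, which is supported on `j` and `l`, leaves the claimed two
  -- terms.
  have hB : B.det = 0 := by
    rw [← Matrix.exists_mulVec_eq_zero_iff]
    refine ⟨v, hv, ?_⟩
    ext i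
    refine Fin.cases ?_ (fun i => ?_) i
    · change w ⬝ᵥ v = 0
      simp [w, sub_dotProduct, mul_comm]
    · exact congrFun h i
  rw [Matrix.det_succ_row_zero] at hB
  have hs : ∀ i : Fin (k + 1), B.submatrix Fin.succ i.succAbove = A.submatrix id i.succAbove := by
    intro i
    rfl
  simp only [hs] at hB
  have hw : ∀ i, B 0 i = w i := fun i => rfl
  simp only [hw] at hB
  have : ∑ i : Fin (k + 1), (-1) ^ (i : ℕ) * w i * (A.submatrix id i.succAbove).det =
      (-1) ^ (j : ℕ) * v l * (A.submatrix id j.succAbove).det -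
      (-1) ^ (l : ℕ) * v j * (A.submatrix id l.succAbove).det := by
    simp only [w, Pi.sub_apply, Pi.smul_apply, smul_eq_mul, mul_sub, sub_mul,
      Finset.sum_sub_distrib, Pi.single_apply, mul_ite, mul_one, mul_zero, ite_mul, zero_mul,
      Finset.sum_ite_eq', Finset.mem_univ, if_true]
  rw [this] at hB
  exact sub_eq_zero.mp hB

theorem val_succAbove {k : ℕ} (j : Fin (k + 1)) (i : Fin k) :
    ((j.succAbove i : Fin (k + 1)) : ℕ) = skip j i := by
  unfold skip Fin.succAbove
  split_ifs <;> simp_all [Fin.lt_def]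

/-! ### Setting one variable to zero. -/

section KillVar

variable {K : Type*} [Field K]

/-- Setting the variable `X k` to zero. -/
def killVar (k : ℕ) : MvPolynomial ℕ K →ₐ[K] MvPolynomial ℕ K :=
  aeval (Function.update X k 0)

theorem killVar_X_self (k : ℕ) : killVar k (X k : MvPolynomial ℕ K) = 0 := by simp [killVar]

theorem killVar_X_ne {k i : ℕ} (h : i ≠ k) : killVar k (X i : MvPolynomial ℕ K) = X i := by
  simp [killVar, h]

theorem skip_ne (k i : ℕ) : skip k i ≠ k := by
  unfold skip; split_ifs <;> omega

theorem sub_aeval_mem (I : Ideal (MvPolynomial ℕ K)) (s : ℕ → MvPolynomial ℕ K)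
    (h : ∀ i, s i - X i ∈ I) (f : MvPolynomial ℕ K) : aeval s f - f ∈ I := by
  have : (Ideal.Quotient.mkₐ K I).comp (aeval s) = Ideal.Quotient.mkₐ K I := by
    ext i : 1
    simpa using Ideal.Quotient.eq.mpr (h i)
  exact Ideal.Quotient.eq.mp (DFunLike.congr_fun this f)

theorem X_dvd_iff (k : ℕ) (f : MvPolynomial ℕ K) : X k ∣ f ↔ killVar k f = 0 := by
  constructor
  · rintro ⟨g, rfl⟩
    rw [map_mul, killVar_X_self, zero_mul]
  · intro h
    have := sub_aeval_mem (Ideal.span {X k}) (Function.update X k 0) (fun i => ?_) f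
    · change killVar k f - f ∈ _ at this
      rw [h, zero_sub, neg_mem_iff, Ideal.mem_span_singleton] at this
      exact this
    · by_cases hi : i = k
      · subst hi
        simp
      · simp [hi]

end KillVar

variable {K : Type*} [Field K] [Fintype K]

/-! ### Generalised Moore determinants -/

/-- The determinant with rows `(s_j ^ q^{e_i})_j`. -/
def gmoore (k : ℕ) (e : Fin k → ℕ) (s : ℕ → MvPolynomial ℕ K) : MvPolynomial ℕ K :=
  (Matrix.of fun i j : Fin k => s j ^ Fintype.card K ^ e i).det

/-- The Moore determinant of the first `k` variables. -/
def mooreDet (K : Type*) [Field K] [Fintype K] (k : ℕ) : MvPolynomial ℕ K :=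
  gmoore k Fin.val X

theorem frob_sum {ι A : Type*} [CommRing A] [Algebra K A] (t : Finset ι) (f : ι → A) (e : ℕ) :
    (∑ i ∈ t, f i) ^ Fintype.card K ^ e = ∑ i ∈ t, f i ^ Fintype.card K ^ e := by
  induction e with
  | zero => simp
  | succ e ih =>
    simp only [pow_succ, pow_mul, ih]
    exact map_sum (FiniteField.frobeniusAlgHom K A) _ t

theorem frob_add {A : Type*} [CommRing A] [Algebra K A] (f g : A) (e : ℕ) :
    (f + g) ^ Fintype.card K ^ e = f ^ Fintype.card K ^ e + g ^ Fintype.card K ^ e := by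
  simpa [Fin.sum_univ_two] using frob_sum (K := K) (Finset.univ : Finset (Fin 2)) ![f, g] e

theorem frob_C {σ : Type*} (c : K) (e : ℕ) :
    (C c : MvPolynomial σ K) ^ Fintype.card K ^ e = C c := by
  rw [← map_pow, FiniteField.pow_card_pow]

theorem aeval_gmoore (k : ℕ) (e : Fin k → ℕ) (s t : ℕ → MvPolynomial ℕ K) :
    aeval s (gmoore k e t) = gmoore k e (fun i => aeval s (t i)) := by
  simp only [gmoore, AlgHom.map_det]
  congr 1
  ext i j
  simp

theorem aeval_mooreDet (k : ℕ) (s : ℕ → MvPolynomial ℕ K) :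
    aeval s (mooreDet K k) = gmoore k Fin.val s := by
  rw [mooreDet, aeval_gmoore]
  simp only [aeval_X]

theorem gmoore_congr (k : ℕ) (e : Fin k → ℕ) {s t : ℕ → MvPolynomial ℕ K}
    (h : ∀ i < k, s i = t i) : gmoore k e s = gmoore k e t := by
  unfold gmoore
  congr 1
  ext i j
  simp [h j j.2]

/-- The entries of `v` lie in 𝔽_q, so raising the relation to the power q^{e_i} does not change its
coefficients. Hence `v` is in the kernel of every matrix of q-power rows, and the minors are
proportional to `v` up to sign, whatever the exponents. -/
theorem gmoore_dep {k : ℕ} (e : Fin k → ℕ) {s : ℕ → MvPolynomial ℕ K} {v : Fin (k + 1) → K}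
    (hv : v ≠ 0) (h : ∑ j, C (v j) * s j = 0) (j l : Fin (k + 1)) :
    (-1) ^ (j : ℕ) * C (v l) * gmoore k e (s ∘ skip j) =
      (-1) ^ (l : ℕ) * C (v j) * gmoore k e (s ∘ skip l) := by
  have := minor_proportional (Matrix.of fun (i : Fin k) (j : Fin (k + 1)) =>
    s j ^ Fintype.card K ^ e i) (v := fun j => C (v j)) ?_ ?_ j l
  · have hm : ∀ i : Fin (k + 1), gmoore k e (s ∘ skip i) =
        ((Matrix.of fun (a : Fin k) (j : Fin (k + 1)) =>
          s j ^ Fintype.card K ^ e a).submatrix id i.succAbove).det := by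
      intro i
      unfold gmoore
      congr 1
      ext a b : 2
      simp [val_succAbove]
    rw [hm, hm]
    exact this
  · intro h0
    apply hv
    ext i
    simpa using congrFun h0 i
  · ext i : 1
    have := congrArg (· ^ Fintype.card K ^ e i) h
    simp only [frob_sum, mul_pow, frob_C] at this
    rw [zero_pow (pow_ne_zero _ Fintype.card_ne_zero)] at this
    simpa [Matrix.mulVec, dotProduct, mul_comm] using this

theorem gmoore_eq_zero {k : ℕ} (e : Fin k → ℕ) {s : ℕ → MvPolynomial ℕ K} {v : Fin k → K}
    (hv : v ≠ 0) (h : ∑ j, C (v j) * s j = 0) : gmoore k e s = 0 := by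
  unfold gmoore
  rw [← Matrix.exists_mulVec_eq_zero_iff]
  refine ⟨fun j => C (v j), ?_, ?_⟩
  · intro h0
    apply hv
    ext i
    simpa using congrFun h0 i
  · ext i : 1
    have := congrArg (· ^ Fintype.card K ^ e i) h
    simp only [frob_sum, mul_pow, frob_C] at this
    rw [zero_pow (pow_ne_zero _ Fintype.card_ne_zero)] at this
    simpa [Matrix.mulVec, dotProduct, mul_comm] using this

/-- Column `i` is divisible by x_i, and after dividing and setting x_i = 0 it becomes (1, 0, …, 0).
The surviving minor has all exponents shifted by one, so it is a q-th power. This shows that x_i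
divides the Moore determinant exactly once, and it is the source of the Frobenius in Φ. -/
theorem mooreDet_col {k : ℕ} (i : Fin (k + 1)) : ∃ R : MvPolynomial ℕ K,
    mooreDet K (k + 1) = X (i : ℕ) * R ∧
      killVar (i : ℕ) R = (-1) ^ (i : ℕ) * rename (skip i) (mooreDet K k) ^ Fintype.card K := by
  have hq : 0 < Fintype.card K := Fintype.card_pos
  let A : Matrix (Fin (k + 1)) (Fin (k + 1)) (MvPolynomial ℕ K) :=
    Matrix.of fun a j => X (j : ℕ) ^ Fintype.card K ^ (a : ℕ)
  let c : Fin (k + 1) → MvPolynomial ℕ K := fun a => X (i : ℕ) ^ (Fintype.card K ^ (a : ℕ) - 1)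
  refine ⟨(A.updateCol i c).det, ?_, ?_⟩
  · have h : A = A.updateCol i ((X (i : ℕ) : MvPolynomial ℕ K) • c) := by
      ext a j
      by_cases hj : j = i
      · subst hj
        simp only [A, c, Matrix.of_apply, Matrix.updateCol_self, Pi.smul_apply, smul_eq_mul]
        rw [← pow_succ', Nat.sub_add_cancel (Nat.pow_pos hq)]
      · simp [A, hj]
    change A.det = _
    conv_lhs => rw [h]
    rw [Matrix.det_updateCol_smul]
  · rw [AlgHom.map_det, Matrix.det_succ_column _ i, Finset.sum_eq_single 0]
    · have hE : rename (skip i) (mooreDet K k) ^ Fintype.card K =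
          (((killVar (i : ℕ)).mapMatrix (A.updateCol i c)).submatrix
            (Fin.succAbove 0) i.succAbove).det := by
        rw [mooreDet, gmoore, AlgHom.map_det]
        change FiniteField.frobeniusAlgHom K (MvPolynomial ℕ K) _ = _
        rw [AlgHom.map_det]
        congr 1
        ext a j : 2
        have : ((i.succAbove j : Fin (k + 1)) : ℕ) ≠ i := by
          rw [val_succAbove]; exact skip_ne _ _
        simp [A, Fin.succAbove_ne, val_succAbove, killVar_X_ne (skip_ne _ _), ← pow_mul, pow_succ]
      rw [hE]
      simp [c]
    · intro a _ ha
      have : c a = X (i : ℕ) * X (i : ℕ) ^ (Fintype.card K ^ (a : ℕ) - 1 - 1) := by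
        have : 2 ≤ Fintype.card K ^ (a : ℕ) :=
          (Fintype.one_lt_card (α := K)).trans_le
            (Nat.le_self_pow (fun h => ha (Fin.ext h)) _)
        simp only [c]
        rw [← pow_succ']
        congr 1
        omega
      simp [this, killVar_X_self]
    · simp

theorem mooreDet_ne_zero (k : ℕ) : mooreDet K k ≠ 0 := by
  induction k with
  | zero => simp [mooreDet, gmoore]
  | succ k ih =>
    obtain ⟨R, h1, h2⟩ := mooreDet_col (K := K) (0 : Fin (k + 1))
    rw [h1]
    refine mul_ne_zero (X_ne_zero _) ?_
    rintro rfl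
    rw [map_zero] at h2
    have := (map_ne_zero_iff _ (rename_injective _ (skip_injective 0))).mpr ih
    exact mul_ne_zero (pow_ne_zero _ (by simp)) (pow_ne_zero _ this) h2.symm

theorem X_sq_not_dvd {k : ℕ} (i : Fin (k + 1)) {R : MvPolynomial ℕ K}
    (hR : mooreDet K (k + 1) = X (i : ℕ) * R) : ¬ X (i : ℕ) ∣ R := by
  obtain ⟨R', h1, h2⟩ := mooreDet_col (K := K) i
  have : R = R' := mul_left_cancel₀ (X_ne_zero (i : ℕ)) (hR.symm.trans h1)
  rw [this, X_dvd_iff, h2]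
  have := (map_ne_zero_iff _ (rename_injective _ (skip_injective i))).mpr (mooreDet_ne_zero (K := K) k)
  refine mul_ne_zero (pow_ne_zero _ (by simp)) (pow_ne_zero _ this)

theorem X_not_dvd_mooreDet {k i : ℕ} (h : k ≤ i) : ¬ X i ∣ mooreDet K k := by
  rw [X_dvd_iff]
  have : killVar i (mooreDet K k) = mooreDet K k := by
    rw [killVar, aeval_mooreDet]
    exact gmoore_congr _ _ fun j hj => by simp [(hj.trans_le h).ne]
  rw [this]
  exact mooreDet_ne_zero k

end

section

/-! ### Linear forms -/

section LinForm

variable {K : Type*} [Field K]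

/-- The linear form `∑ v_j x_j`. -/
def linForm {k : ℕ} (v : Fin k → K) : MvPolynomial ℕ K := ∑ j, C (v j) * X (j : ℕ)

theorem coeff_linForm {k : ℕ} (v : Fin k → K) (j : Fin k) :
    coeff (Finsupp.single (j : ℕ) 1) (linForm v) = v j := by
  unfold linForm
  rw [coeff_sum, Finset.sum_eq_single j]
  · simp
  · intro i _ hi
    rw [coeff_C_mul, coeff_X, if_neg, mul_zero]
    rw [Finsupp.single_left_inj one_ne_zero, Fin.val_inj]
    exact hi
  · simp

theorem linForm_isHomogeneous {k : ℕ} (v : Fin k → K) : (linForm v).IsHomogeneous 1 :=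
  IsHomogeneous.sum _ _ _ fun _ _ => by simpa using (isHomogeneous_C _ _).mul (isHomogeneous_X _ _)

theorem linForm_ne_zero {k : ℕ} {v : Fin k → K} (hv : v ≠ 0) : linForm v ≠ 0 := by
  intro h
  apply hv
  ext j
  rw [← coeff_linForm v j, h]
  simp

theorem prime_linForm {k : ℕ} {v : Fin k → K} (hv : v ≠ 0) : Prime (linForm v) := by
  refine Irreducible.prime (irreducible_of_totalDegree_eq_one
    ((linForm_isHomogeneous v).totalDegree (linForm_ne_zero hv)) fun x hx => ?_)
  obtain ⟨j, hj⟩ := Function.ne_iff.mp hv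
  have := hx (Finsupp.single (j : ℕ) 1)
  rw [coeff_linForm] at this
  exact (ne_zero_of_dvd_ne_zero hj this).isUnit

theorem eq_smul_of_linForm_dvd {k : ℕ} {v w : Fin k → K} (hw : w ≠ 0)
    (h : linForm v ∣ linForm w) : ∃ c : K, w = c • v := by
  obtain ⟨g, hg⟩ := h
  have hw0 := linForm_ne_zero hw
  have hv0 : linForm v ≠ 0 := by rintro h; simp [h] at hg; exact hw0 hg
  have hg0 : g ≠ 0 := by rintro rfl; simp at hg; exact hw0 hg
  have hd := totalDegree_mul_of_isDomain hv0 hg0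
  rw [← hg, (linForm_isHomogeneous w).totalDegree hw0,
    (linForm_isHomogeneous v).totalDegree hv0] at hd
  obtain ⟨c, rfl⟩ : ∃ c, g = C c := ⟨_, totalDegree_eq_zero_iff_eq_C.mp (by omega)⟩
  refine ⟨c, ?_⟩
  ext j
  rw [← coeff_linForm w j, hg, mul_comm, coeff_C_mul, coeff_linForm]
  rfl

theorem prod_prime_dvd {ι R : Type*} [CommRing R] [IsDomain R] (t : Finset ι) (p : ι → R)
    (hp : ∀ i ∈ t, Prime (p i)) (hne : ∀ i ∈ t, ∀ j ∈ t, p i ∣ p j → i = j) (f : R)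
    (h : ∀ i ∈ t, p i ∣ f) : ∏ i ∈ t, p i ∣ f := by
  classical
  induction t using Finset.induction_on generalizing f with
  | empty => simp
  | insert a t ha ih =>
    rw [Finset.prod_insert ha]
    obtain ⟨g, rfl⟩ := h a (Finset.mem_insert_self a t)
    refine mul_dvd_mul_left _ (ih (fun i hi => hp i (Finset.mem_insert_of_mem hi))
      (fun i hi j hj => hne i (Finset.mem_insert_of_mem hi) j (Finset.mem_insert_of_mem hj)) g
      fun i hi => ?_)
    refine ((hp i (Finset.mem_insert_of_mem hi)).dvd_or_dvd
      (h i (Finset.mem_insert_of_mem hi))).resolve_left fun hd => ?_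
    exact ha (hne i (Finset.mem_insert_of_mem hi) a (Finset.mem_insert_self a t) hd ▸ hi)

/-- The generic point of the hyperplane `∑ v_j x_j = 0`, solved for the `l`-th coordinate. -/
def hyper {k : ℕ} (v : Fin k → K) (l : Fin k) : ℕ → MvPolynomial ℕ K :=
  Function.update X (l : ℕ) (X (l : ℕ) - C (v l)⁻¹ * linForm v)

theorem sum_hyper {k : ℕ} {v : Fin k → K} {l : Fin k} (hl : v l ≠ 0) :
    ∑ j, C (v j) * hyper v l j = 0 := by
  have : ∀ j : Fin k, C (v j) * hyper v l j =
      C (v j) * X (j : ℕ) - if j = l then linForm v else 0 := by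
    intro j
    by_cases hj : j = l
    · subst hj
      simp only [hyper, Function.update_self, if_true, mul_sub, ← mul_assoc, ← C_mul,
        mul_inv_cancel₀ hl, C_1, one_mul]
    · simp [hyper, hj, Fin.val_inj]
  simp only [this, Finset.sum_sub_distrib]
  simp [linForm]

theorem hyper_comp_skip {k : ℕ} (v : Fin k → K) (l : Fin k) :
    hyper v l ∘ skip l = X ∘ skip l := by
  ext i : 1
  simp [hyper, skip_ne]

/-- The substitution `hyper` moves each variable by a multiple of the linear form, so it is the
identity modulo that form. -/
theorem linForm_dvd {k : ℕ} {v : Fin k → K} (l : Fin k) {f : MvPolynomial ℕ K}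
    (h : aeval (hyper v l) f = 0) : linForm v ∣ f := by
  have := sub_aeval_mem (Ideal.span {linForm v}) (hyper v l) (fun i => ?_) f
  · rw [h, zero_sub, neg_mem_iff, Ideal.mem_span_singleton] at this
    exact this
  · by_cases hi : i = l
    · subst hi
      simp only [hyper, Function.update_self, sub_sub_cancel_left, neg_mem_iff,
        Ideal.mem_span_singleton]
      exact dvd_mul_left _ _
    · simp [hyper, hi]

end LinForm

/-! ### The numerator of `δ` as an alternating sum -/

section AltSum

variable {K : Type*} [Field K]

theorem rename_eq_aeval (f : ℕ → ℕ) (p : MvPolynomial ℕ K) : rename f p = aeval (X ∘ f) p := by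
  refine DFunLike.congr_fun (?_ : rename f = aeval (X ∘ f)) p
  ext i : 1
  simp

/-- The alternating sum `∑_j (-1)^j x_j^Q F(x_0, …, x̂_j, …)` over `j ≤ r`. -/
def altSum (r Q : ℕ) (F : MvPolynomial ℕ K) : MvPolynomial ℕ K :=
  ∑ j : Fin (r + 1), (-1) ^ (j : ℕ) * X (j : ℕ) ^ Q * rename (skip j) F

theorem aeval_altSum (r Q : ℕ) (F : MvPolynomial ℕ K) (s : ℕ → MvPolynomial ℕ K) :
    aeval s (altSum r Q F) =
      ∑ j : Fin (r + 1), (-1) ^ (j : ℕ) * s j ^ Q * aeval (s ∘ skip j) F := by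
  simp only [altSum, map_sum, map_mul, map_pow, aeval_X, aeval_rename, map_neg, map_one]

theorem skip_skip {i j : ℕ} (h : i ≤ j) (t : ℕ) :
    skip (j + 1) (skip i t) = skip i (skip j t) := by
  unfold skip; split_ifs <;> omega

/-- This is the usual d² = 0: two variables can be omitted in either order, with opposite signs and
the same factor x_i^Q x_j^Q. -/
theorem altSum_altSum (r Q : ℕ) (F : MvPolynomial ℕ K) :
    altSum (r + 1) Q (altSum r Q F) = 0 := by
  have hc : ∀ i j : ℕ, ∀ G : MvPolynomial ℕ K,
      rename (skip i) (rename (skip j) G) = rename (skip i ∘ skip j) G := fun i j G => by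
    rw [rename_rename]
  simp only [altSum, map_sum, map_mul, map_pow, rename_X, map_neg, map_one, Finset.mul_sum, hc]
  rw [← Fintype.sum_prod_type']
  -- The involution exchanges the order of omission. In a pair, the second index is counted after
  -- the first variable has been removed, hence the shifts by one.
  refine Finset.sum_involution
    (fun (p : Fin (r + 1 + 1) × Fin (r + 1)) _ =>
      if h : (p.2 : ℕ) < p.1 then (p.2.castSucc, ⟨p.1 - 1, by omega⟩)
      else (p.2.succ, ⟨p.1, by omega⟩)) ?_ ?_ ?_ ?_
  · rintro ⟨a, b⟩ -
    by_cases h : (b : ℕ) < a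
    · obtain ⟨c, hc⟩ : ∃ c : ℕ, (a : ℕ) = c + 1 := ⟨a - 1, by omega⟩
      have hbc : (b : ℕ) ≤ c := by omega
      have hs : skip (c + 1) ∘ skip b = skip b ∘ skip c := funext (skip_skip hbc)
      have h1 : skip (c + 1) b = b := by unfold skip; split_ifs <;> omega
      have h2 : skip b c = c + 1 := by unfold skip; split_ifs <;> omega
      simp only [dif_pos h]
      simp only [hc, Fin.val_castSucc, Nat.add_sub_cancel, hs, h1, h2]
      ring
    · have hs : skip (b + 1) ∘ skip a = skip a ∘ skip b := funext (skip_skip (by omega))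
      have h1 : skip (b + 1) a = a := by unfold skip; split_ifs <;> omega
      have h2 : skip a b = b + 1 := by unfold skip; split_ifs; omega
      simp only [dif_neg h, Fin.val_succ, hs, h1, h2]
      ring
  · rintro ⟨a, b⟩ - - heq
    by_cases h : (b : ℕ) < a
    · simp [h, Prod.ext_iff, Fin.ext_iff] at heq
      omega
    · simp [h, Prod.ext_iff, Fin.ext_iff] at heq
      omega
  · intros; simp
  · rintro ⟨a, b⟩ -
    by_cases h : (b : ℕ) < a
    · have : ¬ ((a : ℕ) - 1 < b) := by omega
      simp [h, this, Prod.ext_iff, Fin.ext_iff]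
      omega
    · have : (a : ℕ) < b + 1 := by omega
      simp [h, this]

end AltSum

/-! ### Divisibility by the Moore determinant -/

variable {K : Type*} [Field K] [Fintype K]

/-- Every permutation contributes the same degree 1 + q + ⋯ + q^{k-1}, which is also the number of
points of projective (k-1)-space over 𝔽_q. -/
theorem mooreDet_isHomogeneous (k : ℕ) :
    (mooreDet K k).IsHomogeneous (∑ i ∈ Finset.range k, Fintype.card K ^ i) := by
  rw [mooreDet, gmoore, Matrix.det_apply]
  refine IsHomogeneous.sum _ _ _ fun σ _ => ?_
  have h : (∏ i : Fin k, (X (i : ℕ) : MvPolynomial ℕ K) ^ Fintype.card K ^ (σ i : ℕ)).IsHomogeneous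
      (∑ i ∈ Finset.range k, Fintype.card K ^ i) := by
    have := IsHomogeneous.prod (Finset.univ : Finset (Fin k))
      (fun i => (X (i : ℕ) : MvPolynomial ℕ K) ^ Fintype.card K ^ (σ i : ℕ))
      (fun i => Fintype.card K ^ (σ i : ℕ)) (fun i _ => isHomogeneous_X_pow _ _)
    rwa [Equiv.sum_comp σ (fun i : Fin k => Fintype.card K ^ (i : ℕ)),
      Fin.sum_univ_eq_sum_range (fun i => Fintype.card K ^ i)] at this
  rcases Int.units_eq_one_or (Equiv.Perm.sign σ) with hs | hs
  · simpa [hs] using h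
  · simpa [hs] using h.neg

/-- Linear forms of distinct projective points are non-associate primes, and each divides a
polynomial that vanishes on its hyperplane. The Moore determinant is such a polynomial and has the
degree of the product of all these forms, so it is a scalar multiple of that product. -/
theorem mooreDet_dvd {k : ℕ} {f : MvPolynomial ℕ K}
    (h : ∀ (v : Fin k → K) (l : Fin k), v l ≠ 0 → aeval (hyper v l) f = 0) :
    mooreDet K k ∣ f := by
  classical
  have : Fintype (Projectivization K (Fin k → K)) := Fintype.ofFinite _
  let p : Projectivization K (Fin k → K) → MvPolynomial ℕ K := fun P => linForm P.rep
  have hp : ∀ P, Prime (p P) := fun P => prime_linForm P.rep_nonzero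
  have hne : ∀ P Q, p P ∣ p Q → P = Q := by
    intro P Q hPQ
    obtain ⟨c, hc⟩ := eq_smul_of_linForm_dvd Q.rep_nonzero hPQ
    rw [← P.mk_rep, ← Q.mk_rep]
    refine (Projectivization.mk_eq_mk_iff' K _ _ P.rep_nonzero Q.rep_nonzero).mpr ⟨c⁻¹, ?_⟩
    have hc0 : c ≠ 0 := by
      rintro rfl
      exact Q.rep_nonzero (by simpa using hc)
    rw [hc, smul_smul, inv_mul_cancel₀ hc0, one_smul]
  have key : ∀ g : MvPolynomial ℕ K,
      (∀ (v : Fin k → K) (l : Fin k), v l ≠ 0 → aeval (hyper v l) g = 0) → ∏ P, p P ∣ g := by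
    intro g hg
    refine prod_prime_dvd _ _ (fun P _ => hp P) (fun P _ Q _ => hne P Q) _ fun P _ => ?_
    obtain ⟨l, hl⟩ := Function.ne_iff.mp P.rep_nonzero
    exact linForm_dvd l (hg _ l hl)
  obtain ⟨u, hu⟩ := key (mooreDet K k) fun v l hl => by
    rw [aeval_mooreDet]
    exact gmoore_eq_zero _ (fun h0 => hl (by simp [h0])) (sum_hyper hl)
  have hM := mooreDet_ne_zero (K := K) k
  have hP : ∏ P, p P ≠ 0 := by rintro h0; simp [h0] at hu; exact hM hu
  have hu0 : u ≠ 0 := by rintro rfl; simp at hu; exact hM hu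
  have hdeg := totalDegree_mul_of_isDomain hP hu0
  have hPh : (∏ P, p P).IsHomogeneous (∑ i ∈ Finset.range k, Fintype.card K ^ i) := by
    have := IsHomogeneous.prod Finset.univ p (fun _ => 1) fun P _ => linForm_isHomogeneous _
    simp only [Finset.sum_const, Finset.card_univ, smul_eq_mul, mul_one] at this
    rwa [← Nat.card_eq_fintype_card, Projectivization.card_of_finrank K _ (n := k) (by simp),
      Nat.card_eq_fintype_card] at this
  rw [← hu, (mooreDet_isHomogeneous k).totalDegree hM, hPh.totalDegree hP] at hdeg
  obtain ⟨c, rfl⟩ : ∃ c, u = C c := ⟨_, totalDegree_eq_zero_iff_eq_C.mp (by omega)⟩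
  have hc : IsUnit (C c : MvPolynomial ℕ K) :=
    (IsUnit.mk0 c (by rintro rfl; simp at hu0)).map C
  rw [hu, hc.mul_right_dvd]
  exact key f h

/-- Divisibility of the numerator of `δ_{r+1}(f)` by its denominator. -/
def DeltaDvd (r Q : ℕ) (f : MvPolynomial ℕ K) : Prop :=
  mooreDet K (r + 1) ∣ altSum r Q (mooreDet K r * f)

/-- On a list with a linear relation the Moore determinant vanishes, hence so does the alternating
sum. Its minors are proportional to the coefficients ±v_j, and the common factor, a nonzero minor,
cancels. -/
theorem DeltaDvd.sum_eq_zero {r Q : ℕ} {f : MvPolynomial ℕ K} (hf : DeltaDvd r Q f)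
    {s : ℕ → MvPolynomial ℕ K} {v : Fin (r + 1) → K} {l : Fin (r + 1)} (hl : v l ≠ 0)
    (h : ∑ j, C (v j) * s j = 0) (hM : gmoore r Fin.val (s ∘ skip l) ≠ 0) :
    ∑ j : Fin (r + 1), C (v j) * s j ^ Q * aeval (s ∘ skip j) f = 0 := by
  have hv : v ≠ 0 := fun h0 => hl (by simp [h0])
  obtain ⟨g, hg⟩ := hf
  have h1 := congrArg (aeval s) hg
  rw [map_mul, aeval_mooreDet, gmoore_eq_zero _ hv h, zero_mul, aeval_altSum] at h1
  have h2 : (-1) ^ (l : ℕ) * gmoore r Fin.val (s ∘ skip l) *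
      ∑ j : Fin (r + 1), C (v j) * s j ^ Q * aeval (s ∘ skip j) f = 0 := by
    rw [← mul_zero (C (v l)), ← h1, Finset.mul_sum, Finset.mul_sum]
    refine Finset.sum_congr rfl fun j _ => ?_
    rw [map_mul, aeval_mooreDet]
    linear_combination (-s j ^ Q * aeval (s ∘ skip j) f) * gmoore_dep Fin.val hv h j l
  exact (mul_eq_zero.mp h2).resolve_left (mul_ne_zero (pow_ne_zero _ (by simp)) hM)

/-- By `mooreDet_dvd`, generic points of hyperplanes suffice; there the proportionality of minors
can be read backwards. -/
theorem deltaDvd_of_sum_eq_zero {r Q : ℕ} {f : MvPolynomial ℕ K}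
    (h : ∀ (v : Fin (r + 1) → K) (l : Fin (r + 1)), v l ≠ 0 →
      ∑ j : Fin (r + 1), C (v j) * hyper v l j ^ Q * aeval (hyper v l ∘ skip j) f = 0) :
    DeltaDvd r Q f := by
  refine mooreDet_dvd fun v l hl => ?_
  have hv : v ≠ 0 := fun h0 => hl (by simp [h0])
  rw [aeval_altSum]
  have h2 : C (v l) * ∑ j : Fin (r + 1), (-1) ^ (j : ℕ) * hyper v l j ^ Q *
      aeval (hyper v l ∘ skip j) (mooreDet K r * f) = 0 := by
    rw [← mul_zero ((-1) ^ (l : ℕ) * gmoore r Fin.val (hyper v l ∘ skip l)), ← h v l hl,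
      Finset.mul_sum, Finset.mul_sum]
    refine Finset.sum_congr rfl fun j _ => ?_
    rw [map_mul, aeval_mooreDet]
    linear_combination (hyper v l j ^ Q * aeval (hyper v l ∘ skip j) f) *
      gmoore_dep Fin.val hv (sum_hyper hl) j l
  exact (mul_eq_zero.mp h2).resolve_left (by simpa using hl)

theorem gmoore_skip_ne_zero (k l : ℕ) : gmoore k Fin.val ((X : ℕ → MvPolynomial ℕ K) ∘ skip l) ≠ 0 := by
  have : gmoore k Fin.val ((X : ℕ → MvPolynomial ℕ K) ∘ skip l) = rename (skip l) (mooreDet K k) := by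
    rw [rename_eq_aeval, aeval_mooreDet]
  rw [this]
  exact (map_ne_zero_iff _ (rename_injective _ (skip_injective l))).mpr (mooreDet_ne_zero k)

theorem DeltaDvd.hyper_sum {r Q : ℕ} {f : MvPolynomial ℕ K} (hf : DeltaDvd r Q f)
    {v : Fin (r + 1) → K} {l : Fin (r + 1)} (hl : v l ≠ 0) :
    ∑ j : Fin (r + 1), C (v j) * hyper v l j ^ Q * aeval (hyper v l ∘ skip j) f = 0 :=
  hf.sum_eq_zero hl (sum_hyper hl) (by rw [hyper_comp_skip]; exact gmoore_skip_ne_zero r l)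

/-- A relation among the first r + 1 variables is one among r + 2 variables with last coefficient 0.
-/
theorem DeltaDvd.pred {r Q : ℕ} {f : MvPolynomial ℕ K} (hf : DeltaDvd (r + 1) Q f) :
    DeltaDvd r Q f := by
  refine deltaDvd_of_sum_eq_zero fun v l hl => ?_
  have hl' : (Fin.snoc v 0 : Fin (r + 2) → K) l.castSucc ≠ 0 := by simpa using hl
  have h := hf.sum_eq_zero (s := hyper v l) hl' ?_ ?_
  · rw [Fin.sum_univ_castSucc] at h
    simpa using h
  · rw [Fin.sum_univ_castSucc]
    simpa using sum_hyper hl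
  · rw [Fin.val_castSucc, hyper_comp_skip]
    exact gmoore_skip_ne_zero _ _

/-- For f = 1 the required identity is the q^e-th power of the linear relation. -/
theorem deltaDvd_one (r e : ℕ) : DeltaDvd r (Fintype.card K ^ e) (1 : MvPolynomial ℕ K) := by
  refine deltaDvd_of_sum_eq_zero fun v l hl => ?_
  have := congrArg (· ^ Fintype.card K ^ e) (sum_hyper hl)
  simp only [frob_sum, mul_pow, frob_C] at this
  rw [zero_pow (pow_ne_zero _ Fintype.card_ne_zero)] at this
  simpa using this

/-- `g` is `δ_{r+1;b}(f)`, where `Q = q^b`. -/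
def IsDelta (r Q : ℕ) (f g : MvPolynomial ℕ K) : Prop :=
  mooreDet K (r + 1) * g = (-1) ^ r * altSum r Q (mooreDet K r * f)

theorem DeltaDvd.exists_isDelta {r Q : ℕ} {f : MvPolynomial ℕ K} (hf : DeltaDvd r Q f) :
    ∃ g, IsDelta r Q f g := by
  obtain ⟨g, hg⟩ := hf
  exact ⟨(-1) ^ r * g, by rw [IsDelta, hg]; ring⟩

/-- The numerator of the next operator applied to `g` is, up to sign, a double alternating sum, so
it is zero. With `DeltaDvd.pred` this allows δ of a fixed rank to be iterated. -/
theorem IsDelta.deltaDvd {r Q : ℕ} {f g : MvPolynomial ℕ K} (h : IsDelta r Q f g) :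
    DeltaDvd (r + 1) Q g := by
  have : altSum (r + 1) Q (mooreDet K (r + 1) * g) = 0 := by
    rw [h]
    rcases neg_one_pow_eq_or (MvPolynomial ℕ K) r with h1 | h1
    · rw [h1, one_mul, altSum_altSum]
    · have := altSum_altSum r Q (mooreDet K r * f)
      rw [h1, neg_one_mul]
      simp only [altSum, map_neg, mul_neg, Finset.sum_neg_distrib, neg_eq_zero] at this ⊢
      exact this
  rw [DeltaDvd, this]
  exact dvd_zero _

end

section

/-! ### Elementary substitutions -/

section Substitutions

variable {K : Type*} [Field K]

/-- The substitution `x_i ↦ u_i x_i`. -/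
def diag (u : ℕ → K) : MvPolynomial ℕ K →ₐ[K] MvPolynomial ℕ K :=
  aeval fun i => C (u i) * X i

/-- The substitution `x_i ↦ x_i + c x_k`. -/
def shear (i k : ℕ) (c : K) : MvPolynomial ℕ K →ₐ[K] MvPolynomial ℕ K :=
  aeval (Function.update X i (X i + C c * X k))

/-- The substitution `x_i ↦ 0` for `i ≥ n`. -/
def cutoff (n : ℕ) : MvPolynomial ℕ K →ₐ[K] MvPolynomial ℕ K :=
  aeval fun i => if i < n then X i else 0

theorem shear_X_ne {i j : ℕ} (k : ℕ) (c : K) (h : j ≠ i) : shear i k c (X j) = X j := by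
  simp [shear, h]

theorem diag_rename_skip (u : ℕ → K) (j : ℕ) (f : MvPolynomial ℕ K) :
    diag u (rename (skip j) f) = rename (skip j) (diag (u ∘ skip j) f) := by
  refine DFunLike.congr_fun
    (?_ : (diag u).comp (rename (skip j)) = (rename (skip j)).comp (diag (u ∘ skip j))) f
  ext i : 1
  simp [diag]

theorem shear_rename_skip (i k j : ℕ) (c : K) (f : MvPolynomial ℕ K) :
    shear (skip j i) (skip j k) c (rename (skip j) f) = rename (skip j) (shear i k c f) := by
  refine DFunLike.congr_fun
    (?_ : (shear (skip j i) (skip j k) c).comp (rename (skip j)) =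
      (rename (skip j)).comp (shear i k c)) f
  ext t : 1
  by_cases h : t = i
  · subst h; simp [shear]
  · have : skip j t ≠ skip j i := fun h' => h (skip_injective j h')
    simp [shear, h, this]

theorem cutoff_rename_skip {n j : ℕ} (h : j ≤ n) (f : MvPolynomial ℕ K) :
    cutoff (n + 1) (rename (skip j) f) = rename (skip j) (cutoff n f) := by
  refine DFunLike.congr_fun
    (?_ : (cutoff (n + 1)).comp (rename (skip j)) =
      (rename (skip j)).comp (cutoff (K := K) n)) f
  ext t : 1
  have : skip j t < n + 1 ↔ t < n := by unfold skip; split_ifs <;> omega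
  simp only [cutoff, AlgHom.comp_apply, rename_X, aeval_X, this]
  split_ifs <;> simp

theorem cutoff_mono {a b : ℕ} (h : a ≤ b) {f : MvPolynomial ℕ K} (hf : cutoff a f = f) :
    cutoff b f = f := by
  have : (cutoff b).comp (cutoff a) = cutoff (K := K) a := by
    ext t : 1
    simp only [cutoff, AlgHom.comp_apply, aeval_X]
    split_ifs with h1
    · simp [h1.trans_le h]
    · simp
  rw [← hf]
  exact DFunLike.congr_fun this f

theorem X_dvd_shear_sub (i k : ℕ) (c : K) (f : MvPolynomial ℕ K) :
    X k ∣ shear i k c f - f := by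
  rw [← Ideal.mem_span_singleton]
  refine sub_aeval_mem _ _ (fun t => ?_) f
  by_cases h : t = i
  · subst h
    simp [Ideal.mem_span_singleton]
  · simp [h]

/-- The variables with `x_i + c x_k` inserted after `x_i`. -/
def insertSum (i k : ℕ) (c : K) (t : ℕ) : MvPolynomial ℕ K :=
  if t ≤ i then X t else if t = i + 1 then X i + C c * X k else X (t - 1)

theorem insertSum_comp_succ (i k : ℕ) (c : K) : insertSum i k c ∘ skip (i + 1) = X := by
  ext t : 1
  simp only [insertSum, skip, Function.comp_apply]
  split_ifs <;> first | omega | simp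

/-- Omitting entry i + 1 of the extended list restores the variables, while omitting entry i
performs the shear. An identity over all omissions therefore compares a polynomial with its shear.
-/
theorem insertSum_comp_self (i k : ℕ) (c : K) :
    insertSum i k c ∘ skip i = Function.update X i (X i + C c * X k) := by
  ext t : 1
  rcases lt_trichotomy t i with h | rfl | h
  · simp [insertSum, skip, h, h.le, h.ne]
  · simp [insertSum, skip]
  · have : ¬ t < i := by omega
    have h2 : ¬ t + 1 ≤ i := by omega
    simp [insertSum, skip, h.ne', this, h2]

/-- The coefficients of the linear relation between the vectors `insertSum`. -/
def insertRel (r i k : ℕ) (c : K) (t : Fin (r + 2)) : K :=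
  (if (t : ℕ) = i then 1 else 0) + (if (t : ℕ) = k then c else 0) - if (t : ℕ) = i + 1 then 1 else 0

theorem sum_insertRel {r i k : ℕ} (hki : k < i) (hi : i ≤ r) (c : K)
    (f : Fin (r + 2) → MvPolynomial ℕ K) :
    ∑ t, C (insertRel r i k c t) * f t =
      f ⟨i, by omega⟩ + C c * f ⟨k, by omega⟩ - f ⟨i + 1, by omega⟩ := by
  have h : ∀ (a : K) (t : ℕ) (ht : t < r + 2),
      ∑ j : Fin (r + 2), (if (j : ℕ) = t then C a else 0) * f j = C a * f ⟨t, ht⟩ := by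
    intro a t ht
    rw [Finset.sum_eq_single ⟨t, ht⟩]
    · simp
    · intro j _ hj
      rw [if_neg (fun h => hj (Fin.ext h)), zero_mul]
    · simp
  have h' : ∀ (p : Prop) [Decidable p] (a : K),
      (C (if p then a else 0) : MvPolynomial ℕ K) = if p then C a else 0 := by
    intro p _ a; split_ifs <;> simp
  simp only [insertRel, C_add, C_sub, add_mul, sub_mul, Finset.sum_add_distrib,
    Finset.sum_sub_distrib, h']
  rw [h 1 i (by omega), h c k (by omega), h 1 (i + 1) (by omega)]
  simp

theorem sum_insertSum {r i k : ℕ} (hki : k < i) (hi : i ≤ r) (c : K) :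
    ∑ t, C (insertRel r i k c t) * insertSum i k c (t : ℕ) = 0 := by
  rw [sum_insertRel hki hi c (fun t => insertSum i k c (t : ℕ))]
  simp [insertSum, hki.le]

end Substitutions

variable {K : Type*} [Field K] [Fintype K]

theorem diag_mooreDet (u : ℕ → K) (k : ℕ) :
    diag u (mooreDet K k) = C (∏ i : Fin k, u i) * mooreDet K k := by
  rw [diag, aeval_mooreDet, map_prod, mooreDet, gmoore, gmoore, ← Matrix.det_mul_row]
  congr 1
  ext a j : 2
  simp [mul_pow, frob_C]

theorem shear_mooreDet {i a : ℕ} (k : ℕ) (c : K) (h : a ≤ i) :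
    shear i k c (mooreDet K a) = mooreDet K a := by
  rw [shear, aeval_mooreDet]
  exact gmoore_congr _ _ fun j hj => by simp [(hj.trans_le h).ne]

theorem cutoff_mooreDet {n a : ℕ} (h : a ≤ n) : cutoff n (mooreDet K a) = mooreDet K a := by
  rw [cutoff, aeval_mooreDet]
  exact gmoore_congr _ _ fun j hj => by simp [hj.trans_le h]

theorem X_dvd_mooreDet {k a : ℕ} (h : k < a) : X k ∣ mooreDet K a := by
  obtain ⟨a, rfl⟩ : ∃ b, a = b + 1 := ⟨a - 1, by omega⟩
  obtain ⟨R, h1, -⟩ := mooreDet_col (K := K) (⟨k, h⟩ : Fin (a + 1))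
  exact ⟨R, h1⟩

/-! ### The class of polynomials on which `δ` acts -/

/-- The numerator of `δ_{r+1}(f)` is divisible by its denominator, `f` is invariant under diagonal
substitutions, and invariant under `x_i ↦ x_i + c x_k` modulo `x_k^Q` for `k < i`. -/
structure Good (r Q : ℕ) (f : MvPolynomial ℕ K) : Prop where
  dvd : DeltaDvd r Q f
  diag_eq : ∀ u : ℕ → K, (∀ i, u i ≠ 0) → diag u f = f
  shear_sub : ∀ i k : ℕ, k < i → ∀ c : K, X k ^ Q ∣ shear i k c f - f

theorem Good.pred {r Q : ℕ} {f : MvPolynomial ℕ K} (h : Good (r + 1) Q f) : Good r Q f :=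
  ⟨h.dvd.pred, h.diag_eq, h.shear_sub⟩

theorem good_one (r e : ℕ) : Good r (Fintype.card K ^ e) (1 : MvPolynomial ℕ K) :=
  ⟨deltaDvd_one r e, fun _ _ => map_one _, fun _ _ _ _ => by simp⟩

/-- Since u^{q^e} = u on 𝔽_q, numerator and denominator are both multiplied by the product of the
first r + 1 scalars. -/
theorem IsDelta.diag_eq {r e : ℕ} {f g : MvPolynomial ℕ K}
    (h : IsDelta r (Fintype.card K ^ e) f g)
    (hf : ∀ u : ℕ → K, (∀ i, u i ≠ 0) → diag u f = f) (u : ℕ → K) (hu : ∀ i, u i ≠ 0) :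
    diag u g = g := by
  have hc : (C (∏ i : Fin (r + 1), u i) : MvPolynomial ℕ K) ≠ 0 := by
    rw [Ne, C_eq_zero]
    exact Finset.prod_ne_zero_iff.mpr fun i _ => hu _
  refine mul_left_cancel₀ (mul_ne_zero hc (mooreDet_ne_zero (K := K) (r + 1))) ?_
  rw [← diag_mooreDet, ← map_mul, h, diag_mooreDet, mul_assoc, h, mul_left_comm, map_mul, map_pow,
    map_neg, map_one]
  congr 1
  simp only [altSum, map_sum, Finset.mul_sum, map_mul]
  refine Finset.sum_congr rfl fun j _ => ?_
  rw [diag_rename_skip, diag_rename_skip, hf (u ∘ skip j) fun i => hu _, diag_mooreDet, map_mul, rename_C,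
    Fin.prod_univ_succAbove _ j]
  simp only [val_succAbove, map_pow, map_neg, map_one, C_mul, Function.comp_apply]
  simp only [diag, aeval_X, mul_pow, frob_C]
  ring

/-- The relation x_i + c x_k - (x_i + c x_k) = 0 on the extended list gives x_i^Q (shear g - g) = c
x_k^Q (⋯), where Q = q^e, and x_k is prime to x_i. -/
theorem DeltaDvd.shear_sub {r e i k : ℕ} {g : MvPolynomial ℕ K}
    (hg : DeltaDvd (r + 1) (Fintype.card K ^ e) g) (hki : k < i) (hi : i ≤ r) (c : K) :
    X k ^ Fintype.card K ^ e ∣ shear i k c g - g := by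
  have hl : insertRel r i k c ⟨i + 1, by omega⟩ ≠ 0 := by
    have h1 : ¬ i + 1 = k := by omega
    simp [insertRel, h1]
  have h := hg.sum_eq_zero hl (sum_insertSum hki hi c) (by
    simp only [insertSum_comp_succ]
    exact mooreDet_ne_zero (r + 1))
  simp only [mul_assoc] at h
  rw [sum_insertRel hki hi c fun t =>
    insertSum i k c (t : ℕ) ^ Fintype.card K ^ e * aeval (insertSum i k c ∘ skip t) g] at h
  simp only [insertSum_comp_succ, insertSum_comp_self] at h
  have h1 : insertSum i k c i = X i := by simp [insertSum]
  have h2 : insertSum i k c k = X k := by simp [insertSum, hki.le]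
  have h3 : insertSum i k c (i + 1) = X i + C c * X k := by simp [insertSum]
  rw [h1, h2, h3, aeval_X_left_apply, frob_add, mul_pow, frob_C] at h
  change _ * shear i k c g + _ - _ = 0 at h
  refine (X_prime (R := K) (i := k)).pow_dvd_of_dvd_mul_left _ (a := X i ^ Fintype.card K ^ e) ?_
    ⟨C c * (g - aeval (insertSum i k c ∘ skip k) g), by linear_combination h⟩
  intro hd
  have := (X_dvd_X (R := K)).mp ((X_prime (R := K) (i := k)).dvd_of_dvd_pow hd)
  omega

/-- For i > r the variable x_i occurs in the numerator only through copies of `f`, so the invariance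
of `f` is inherited. The care needed is with the factor x_k in the denominator, present when k ≤ r.
-/
theorem IsDelta.shear_sub {r e i k : ℕ} {f g : MvPolynomial ℕ K}
    (h : IsDelta r (Fintype.card K ^ e) f g)
    (hf : ∀ i k : ℕ, k < i → ∀ c : K, X k ^ Fintype.card K ^ e ∣ shear i k c f - f)
    (hki : k < i) (hi : r < i) (c : K) :
    X k ^ Fintype.card K ^ e ∣ shear i k c g - g := by
  set Q := Fintype.card K ^ e with hQ
  have hfix : ∀ j : Fin (r + 1), shear i k c (rename (skip j) (mooreDet K r)) =
      rename (skip j) (mooreDet K r) := by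
    intro j
    rw [rename_eq_aeval, aeval_mooreDet, shear, aeval_gmoore]
    refine gmoore_congr _ _ fun t ht => ?_
    have : skip j t ≠ i := by unfold skip; split_ifs <;> omega
    simp [this]
  have key : mooreDet K (r + 1) * (shear i k c g - g) = (-1) ^ r * ∑ j : Fin (r + 1),
      (-1) ^ (j : ℕ) * (X (j : ℕ) ^ Q * (rename (skip j) (mooreDet K r) *
        (shear i k c (rename (skip j) f) - rename (skip j) f))) := by
    have h1 := congrArg (shear i k c) h
    rw [map_mul, shear_mooreDet k c (show r + 1 ≤ i by omega)] at h1
    rw [mul_sub, h1, h, map_mul, map_pow, map_neg, map_one, ← mul_sub]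
    congr 1
    simp only [altSum, map_sum, ← Finset.sum_sub_distrib]
    refine Finset.sum_congr rfl fun j _ => ?_
    simp only [map_mul, map_pow, map_neg, map_one, hfix,
      shear_X_ne k c (show (j : ℕ) ≠ i by omega)]
    ring
  have hdiff : ∀ j : Fin (r + 1), (j : ℕ) ≠ k →
      X k ^ Q ∣ shear i k c (rename (skip j) f) - rename (skip j) f := by
    intro j hj
    obtain ⟨i', hi'⟩ : ∃ i', skip j i' = i := ⟨i - 1, by unfold skip; split_ifs <;> omega⟩
    obtain ⟨k', hk'⟩ : ∃ k', skip j k' = k := by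
      rcases lt_or_gt_of_ne hj with h' | h'
      · exact ⟨k - 1, by unfold skip; split_ifs <;> omega⟩
      · exact ⟨k, by unfold skip; split_ifs <;> omega⟩
    have hlt : k' < i' := by
      unfold skip at hi' hk'; split_ifs at hi' hk' <;> omega
    have := map_dvd (rename (skip j)) (hf i' k' hlt c)
    rwa [map_sub, ← shear_rename_skip, hi', hk', map_pow, rename_X, hk'] at this
  by_cases hk : k ≤ r
  · obtain ⟨R, hR, -⟩ := mooreDet_col (K := K) (⟨k, by omega⟩ : Fin (r + 1))
    have hRk := X_sq_not_dvd _ hR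
    refine (X_prime (R := K) (i := k)).pow_dvd_of_dvd_mul_left _ hRk ?_
    -- The denominator contains x_k exactly once, so the numerator must be divisible by x_k^{Q+1}.
    -- The summand j = k has x_k^Q in front and gains one factor since the shear is trivial modulo
    -- x_k; the others gain it from the minor, which still involves x_k.
    refine (mul_dvd_mul_iff_left (X_ne_zero (R := K) k)).mp ?_
    rw [← mul_assoc, ← hR, key, ← pow_succ']
    refine Dvd.dvd.mul_left (Finset.dvd_sum fun j _ => Dvd.dvd.mul_left ?_ _) _
    by_cases hj : (j : ℕ) = k
    · rw [hj, pow_succ]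
      exact mul_dvd_mul_left _ (Dvd.dvd.mul_left (X_dvd_shear_sub _ _ _ _) _)
    · refine Dvd.dvd.mul_left ?_ _
      rw [pow_succ']
      refine mul_dvd_mul ?_ (hdiff j hj)
      obtain ⟨k', hk', hkr⟩ : ∃ k', skip j k' = k ∧ k' < r := by
        rcases lt_or_gt_of_ne hj with h' | h'
        · exact ⟨k - 1, by unfold skip; split_ifs <;> omega, by omega⟩
        · exact ⟨k, by unfold skip; split_ifs <;> omega, by omega⟩
      have := map_dvd (rename (skip j)) (X_dvd_mooreDet (K := K) hkr)
      rwa [rename_X, hk'] at this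
  · refine (X_prime (R := K) (i := k)).pow_dvd_of_dvd_mul_left _
      (X_not_dvd_mooreDet (show r + 1 ≤ k by omega)) ?_
    rw [key]
    exact Dvd.dvd.mul_left (Finset.dvd_sum fun j _ => Dvd.dvd.mul_left (Dvd.dvd.mul_left
      (Dvd.dvd.mul_left (hdiff j (by omega)) _) _) _) _

theorem Good.isDelta {r e : ℕ} {f g : MvPolynomial ℕ K} (hf : Good r (Fintype.card K ^ e) f)
    (h : IsDelta r (Fintype.card K ^ e) f g) : Good (r + 1) (Fintype.card K ^ e) g where
  dvd := h.deltaDvd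
  diag_eq := h.diag_eq hf.diag_eq
  shear_sub i k hki c := by
    by_cases hi : i ≤ r
    · exact h.deltaDvd.shear_sub hki hi c
    · exact h.shear_sub hf.shear_sub hki (by omega) c

theorem IsDelta.cutoff_eq {r Q n : ℕ} {f g : MvPolynomial ℕ K} (h : IsDelta r Q f g) (hr : r ≤ n)
    (hf : cutoff n f = f) : cutoff (n + 1) g = g := by
  refine mul_left_cancel₀ (mooreDet_ne_zero (K := K) (r + 1)) ?_
  have h1 := congrArg (cutoff (n + 1)) h
  rw [map_mul, cutoff_mooreDet (show r + 1 ≤ n + 1 by omega)] at h1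
  rw [h1, h, map_mul, map_pow, map_neg, map_one]
  congr 1
  simp only [altSum, map_sum]
  refine Finset.sum_congr rfl fun j _ => ?_
  have hj : (j : ℕ) < n + 1 := by omega
  rw [map_mul, cutoff_rename_skip (show (j : ℕ) ≤ n by omega),
    map_mul (cutoff n), hf, cutoff_mooreDet hr]
  have hX : cutoff (n + 1) (X (j : ℕ)) = (X (j : ℕ) : MvPolynomial ℕ K) := by
    simp only [cutoff, aeval_X, if_pos hj]
  simp [hX]

/-- The numerator of `δ_{r+1;b}(f)` as a determinant. -/
theorem altSum_eq_det (r Q : ℕ) (f : MvPolynomial ℕ K) :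
    (-1) ^ r * altSum r Q (mooreDet K r * f) =
      (Matrix.of fun i j : Fin (r + 1) =>
        if (i : ℕ) + 1 = r + 1 then X (j : ℕ) ^ Q * rename (skip j) f
        else X (j : ℕ) ^ Fintype.card K ^ (i : ℕ)).det := by
  rw [Matrix.det_succ_row _ (Fin.last r), altSum, Finset.mul_sum]
  refine Finset.sum_congr rfl fun j _ => ?_
  have : rename (skip j) (mooreDet K r) = (Matrix.submatrix (Matrix.of fun i j : Fin (r + 1) =>
        if (i : ℕ) + 1 = r + 1 then X (j : ℕ) ^ Q * rename (skip j) f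
        else X (j : ℕ) ^ Fintype.card K ^ (i : ℕ)) (Fin.last r).succAbove j.succAbove).det := by
    rw [rename_eq_aeval, aeval_mooreDet, gmoore]
    congr 1
    ext a b : 2
    simp [val_succAbove, a.2.ne]
  rw [← this]
  simp [pow_add]
  ring

/-! ### The Dickson invariants `D_a` -/

/-- The exponents of the numerator of `D_{r+1}`. -/
def dicksonExp (r : ℕ) (i : Fin (r + 1)) : ℕ := if (i : ℕ) + 1 = r + 1 then r + 1 else i

/-- `d` is the Dickson invariant `D_{r+1}`. -/
abbrev IsDickson (r : ℕ) (d : MvPolynomial ℕ K) : Prop :=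
  IsDelta r (Fintype.card K ^ (r + 1)) 1 d

theorem IsDelta.dickson {r : ℕ} {d : MvPolynomial ℕ K} (hd : IsDickson r d) :
    mooreDet K (r + 1) * d = gmoore (r + 1) (dicksonExp r) X := by
  rw [hd, altSum_eq_det, gmoore]
  congr 1
  ext a b : 2
  simp only [Matrix.of_apply, dicksonExp]
  split_ifs <;> simp

theorem exists_isDickson (K : Type*) [Field K] [Fintype K] (r : ℕ) :
    ∃ d : MvPolynomial ℕ K, IsDickson r d :=
  (deltaDvd_one r (r + 1)).exists_isDelta

/-- The Dickson invariant is a quotient of two determinants of q-power rows, and the minors of both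
are proportional to the same vector. Their quotient thus takes the same value on the two sublists.
-/
theorem IsDelta.dickson_eq {r : ℕ} {d : MvPolynomial ℕ K} (hd : IsDickson r d)
    {s : ℕ → MvPolynomial ℕ K} {v : Fin (r + 2) → K} {j l : Fin (r + 2)} (hj : v j ≠ 0)
    (h : ∑ j, C (v j) * s j = 0) (hM : gmoore (r + 1) Fin.val (s ∘ skip l) ≠ 0) :
    aeval (s ∘ skip j) d = aeval (s ∘ skip l) d := by
  have hv : v ≠ 0 := fun h0 => hj (by simp [h0])
  have hN : ∀ t : Fin (r + 2), gmoore (r + 1) Fin.val (s ∘ skip t) * aeval (s ∘ skip t) d =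
      gmoore (r + 1) (dicksonExp r) (s ∘ skip t) := by
    intro t
    have := congrArg (aeval (s ∘ skip t)) hd.dickson
    rw [map_mul, aeval_mooreDet, aeval_gmoore] at this
    simpa only [aeval_X] using this
  have h1 := gmoore_dep Fin.val hv h j l
  have h2 := gmoore_dep (dicksonExp r) hv h j l
  rw [← hN, ← hN] at h2
  have hc : (-1) ^ (l : ℕ) * C (v j) * gmoore (r + 1) Fin.val (s ∘ skip l) ≠ 0 :=
    mul_ne_zero (mul_ne_zero (pow_ne_zero _ (by simp)) (by simpa using hj)) hM
  refine mul_left_cancel₀ hc ?_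
  linear_combination h2 - aeval (s ∘ skip j) d * h1

theorem IsDelta.dickson_shear {r i k : ℕ} {d : MvPolynomial ℕ K} (hd : IsDickson r d)
    (hki : k < i) (c : K) : shear i k c d = d := by
  by_cases hi : i ≤ r
  · have hj : insertRel r i k c ⟨i, by omega⟩ ≠ 0 := by
      have h1 : ¬ i = k := by omega
      simp [insertRel, h1]
    have := hd.dickson_eq (l := ⟨i + 1, by omega⟩) hj (sum_insertSum hki hi c) (by
      simp only [insertSum_comp_succ]
      exact mooreDet_ne_zero (r + 1))
    simp only [insertSum_comp_succ, insertSum_comp_self, aeval_X_left_apply] at this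
    exact this
  · refine mul_left_cancel₀ (mooreDet_ne_zero (K := K) (r + 1)) ?_
    have h1 := congrArg (shear i k c) hd.dickson
    rw [map_mul, shear_mooreDet k c (show r + 1 ≤ i by omega)] at h1
    rw [h1, hd.dickson, shear, aeval_gmoore]
    refine gmoore_congr _ _ fun t ht => ?_
    have : t ≠ i := by omega
    simp [this]

/-- On a hyperplane the Dickson invariant has one common value on all sublists with v_j ≠ 0, so its
power factors out of the identity for `f`. Shears fix it exactly. -/
theorem Good.dickson_mul {r e : ℕ} {f d : MvPolynomial ℕ K} (hd : IsDickson r d)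
    (hf : Good (r + 1) (Fintype.card K ^ e) f) (a : ℕ) :
    Good (r + 1) (Fintype.card K ^ e) (d ^ a * f) where
  dvd := by
    refine deltaDvd_of_sum_eq_zero fun v l hl => ?_
    rw [← mul_zero (aeval (hyper v l ∘ skip l) d ^ a), ← hf.dvd.hyper_sum hl, Finset.mul_sum]
    refine Finset.sum_congr rfl fun j _ => ?_
    by_cases hj : v j = 0
    · simp [hj]
    · rw [map_mul, map_pow, hd.dickson_eq (l := l) hj (sum_hyper hl) (by
        rw [hyper_comp_skip]
        exact gmoore_skip_ne_zero _ _)]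
      ring
  diag_eq u hu := by
    rw [map_mul, map_pow, hf.diag_eq u hu,
      hd.diag_eq (fun _ _ => map_one _) u hu]
  shear_sub i k hki c := by
    rw [map_mul, map_pow, hd.dickson_shear hki, ← mul_sub]
    exact Dvd.dvd.mul_left (hf.shear_sub i k hki c) _

end

section

section

variable {K : Type*} [Field K]

theorem omitVar_algebraMap (j : ℕ) (f : MvPolynomial ℕ K) :
    omitVar K j (algebraMap _ _ f) = algebraMap _ (RatField K) (rename (skip j) f) := by
  rw [omitVar, IsFractionRing.map, IsLocalization.map_eq]
  rfl

theorem algebraMap_ratField_injective :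
    Function.Injective (algebraMap (MvPolynomial ℕ K) (RatField K)) :=
  FaithfulSMul.algebraMap_injective _ _

theorem killVar_zero_rename_skip_succ (j : ℕ) (f : MvPolynomial ℕ K) :
    killVar 0 (rename (skip (j + 1)) f) = rename (skip (j + 1)) (killVar 0 f) := by
  refine DFunLike.congr_fun (?_ : (killVar 0).comp (rename (skip (j + 1))) =
    (rename (skip (j + 1))).comp (killVar 0)) f
  ext i : 1
  cases i with
  | zero => simp [killVar, skip]
  | succ i =>
    have : skip (j + 1) (i + 1) ≠ 0 := by unfold skip; split_ifs <;> omega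
    simp [killVar, this]

end

variable {K : Type*} [Field K] [Fintype K]

/-! ### The expressions `Y_b(I; J)` are polynomials -/

theorem IsDelta.delta_eq {r b : ℕ} {f g : MvPolynomial ℕ K}
    (h : IsDelta r (Fintype.card K ^ b) f g) :
    delta K (r + 1) b (algebraMap _ _ f) = algebraMap _ (RatField K) g := by
  have h1 : (mooreMatrix K (r + 1)).det = algebraMap _ (RatField K) (mooreDet K (r + 1)) := by
    rw [mooreDet, gmoore, RingHom.map_det]
    congr 1
    ext i j : 2
    simp [mooreMatrix, x]
  have h2 : (deltaMatrix K (r + 1) b (algebraMap _ _ f)).det = algebraMap _ (RatField K)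
      ((-1) ^ r * altSum r (Fintype.card K ^ b) (mooreDet K r * f)) := by
    rw [altSum_eq_det, RingHom.map_det]
    congr 1
    ext i j : 2
    simp only [deltaMatrix, Matrix.of_apply, omitVar_algebraMap, RingHom.mapMatrix_apply,
      Matrix.map_apply, x]
    split_ifs <;> simp
  rw [delta, h1, h2, ← h, map_mul, mul_div_cancel_left₀]
  rw [Ne, FaithfulSMul.algebraMap_eq_zero_iff]
  exact mooreDet_ne_zero _

theorem IsDelta.D_eq {r : ℕ} {d : MvPolynomial ℕ K} (h : IsDickson r d) :
    D K (r + 1) = algebraMap _ (RatField K) d := by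
  rw [D, ← h.delta_eq, map_one]

/-- Cancel the single factor x_0 of the larger Moore determinant. At x_0 = 0 the summand omitting
x_0 vanishes, because it keeps x_0^{q^{b+1}-1}; every other factor becomes a shifted q-th power.
What remains is the Frobenius image of the defining equation of `g`. -/
theorem IsDelta.killVar_eq {r b : ℕ} {f g f' g' : MvPolynomial ℕ K}
    (h : IsDelta r (Fintype.card K ^ b) f g) (h' : IsDelta (r + 1) (Fintype.card K ^ (b + 1)) f' g')
    (hf : killVar 0 f' = rename Nat.succ f ^ Fintype.card K) :
    killVar 0 g' = rename Nat.succ g ^ Fintype.card K := by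
  have hs0 : skip 0 = Nat.succ := by ext i; simp [skip]
  obtain ⟨R, hR, hR0⟩ := mooreDet_col (K := K) (0 : Fin (r + 1 + 1))
  obtain ⟨R1, hR1, hR10⟩ := mooreDet_col (K := K) (0 : Fin (r + 1))
  simp only [Fin.val_zero, pow_zero, one_mul, hs0] at hR hR0 hR1 hR10
  let φ := FiniteField.frobeniusAlgHom K (MvPolynomial ℕ K)
  have hφ : ∀ p, p ^ Fintype.card K = φ p := fun _ => rfl
  have hq : 2 ≤ Fintype.card K ^ (b + 1) :=
    (Fintype.one_lt_card (α := K)).trans_le (Nat.le_self_pow b.succ_ne_zero _)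
  have key : R * g' = (-1) ^ (r + 1) * (X 0 ^ (Fintype.card K ^ (b + 1) - 1) *
      rename Nat.succ (mooreDet K (r + 1) * f') +
      ∑ j : Fin (r + 1), (-1) ^ ((j : ℕ) + 1) * X ((j : ℕ) + 1) ^ Fintype.card K ^ (b + 1) *
        rename (skip (j + 1)) (R1 * f')) := by
    refine mul_left_cancel₀ (X_ne_zero (R := K) 0) ?_
    rw [← mul_assoc, ← hR, h', altSum, Fin.sum_univ_succ, mul_left_comm]
    congr 1
    rw [mul_add, Finset.mul_sum, ← mul_assoc, ← pow_succ', Nat.sub_add_cancel (by omega)]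
    congr 1
    · simp [hs0]
    · refine Finset.sum_congr rfl fun j _ => ?_
      simp only [hR1, map_mul, rename_X, Fin.val_succ, skip, Nat.succ_pos, if_true]
      ring
  have h1 := congrArg (killVar 0) key
  rw [map_mul, hR0, hφ, map_mul, map_add, map_mul (killVar 0) (X 0 ^ _), map_pow _ (X 0),
    killVar_X_self, zero_pow (by omega), zero_mul, zero_add] at h1
  have h2 := congrArg (fun p => φ (rename Nat.succ p)) h
  simp only [altSum, map_sum, map_mul, map_pow, map_neg, map_one] at h2
  simp only [map_sum, map_mul, map_pow, map_neg, map_one] at h1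
  rw [hφ]
  have hM : φ (rename Nat.succ (mooreDet K (r + 1))) ≠ 0 :=
    pow_ne_zero _ ((map_ne_zero_iff _ (rename_injective _ Nat.succ_injective)).mpr
      (mooreDet_ne_zero _))
  refine mul_left_cancel₀ hM ?_
  rw [h1, h2, pow_succ, mul_assoc, neg_one_mul, ← Finset.sum_neg_distrib]
  congr 1
  refine Finset.sum_congr rfl fun j _ => ?_
  have hc : ∀ p : MvPolynomial ℕ K, rename Nat.succ (rename (skip j) p) =
      rename (skip (j + 1)) (rename Nat.succ p) := by
    intro p
    rw [rename_rename, rename_rename]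
    have : Nat.succ ∘ skip j = skip (j + 1) ∘ Nat.succ := by
      ext i
      simp only [skip, Function.comp_apply]
      split_ifs <;> omega
    rw [this]
  rw [killVar_zero_rename_skip_succ, killVar_zero_rename_skip_succ, hR10, hf,
    killVar_X_ne (Nat.succ_ne_zero _), hc, hc]
  simp only [hφ, rename_X]
  rw [← hφ (X _), ← pow_mul, ← pow_succ']
  simp only [← hφ, map_pow]
  ring

/-- `f` is the rational function given by the polynomial `p` in `n` variables, on which
`δ_{r+1;b}` acts. -/
structure Represents (r b n : ℕ) (f : RatField K) (p : MvPolynomial ℕ K) : Prop where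
  eq : algebraMap _ _ p = f
  good : Good r (Fintype.card K ^ b) p
  cutoff_eq : cutoff n p = p

theorem Represents.delta {r b n : ℕ} {f : RatField K} {p : MvPolynomial ℕ K}
    (h : Represents r b n f p) (hr : r ≤ n) :
    ∃ g, IsDelta r (Fintype.card K ^ b) p g ∧ Represents r b (n + 1) (delta K (r + 1) b f) g := by
  obtain ⟨g, hg⟩ := h.good.dvd.exists_isDelta
  -- δ raises the rank of goodness by one; `pred` brings it back to `r`, so that the same operator
  -- can be applied again.
  exact ⟨g, hg, by rw [← h.eq, hg.delta_eq], (h.good.isDelta hg).pred, hg.cutoff_eq hr h.cutoff_eq⟩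

/-- The number of variables in `Y_b(I; J)`. -/
def numVars (w : List (ℕ × ℕ)) : ℕ := (w.map fun p => p.1 + 1).sum

/-- The expression and its image under raising both the rank and `b` by one are built in parallel,
so that the relation at x_0 = 0 is carried through every δ and every Dickson factor. -/
theorem exists_represents_pair (b : ℕ) (w : List (ℕ × ℕ)) (a : ℕ) :
    ∃ p p' : MvPolynomial ℕ K, Represents a b (a + numVars w) (Yfrom K b (a + 1) w) p ∧
      Represents (a + 1) (b + 1) (a + 1 + numVars w) (Yfrom K (b + 1) (a + 1 + 1) w) p' ∧
      killVar 0 p' = rename Nat.succ p ^ Fintype.card K := by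
  induction w generalizing a with
  | nil =>
    exact ⟨1, 1, ⟨by simp [Yfrom], good_one _ _, map_one _⟩,
      ⟨by simp [Yfrom], good_one _ _, map_one _⟩, by simp⟩
  | cons t w ih =>
    obtain ⟨i, j⟩ := t
    obtain ⟨p, p', hp, hp', hpp⟩ := ih (a + 1)
    obtain ⟨d, hd⟩ := exists_isDickson K a
    obtain ⟨d', hd'⟩ := exists_isDickson K (a + 1)
    have hdc : cutoff (a + 1) d = d := hd.cutoff_eq le_rfl (map_one _)
    have hdc' : cutoff (a + 1 + 1) d' = d' := hd'.cutoff_eq le_rfl (map_one _)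
    have hdd : killVar 0 d' = rename Nat.succ d ^ Fintype.card K := hd.killVar_eq hd' (by simp)
    -- The list is built from the inside: first the power of the Dickson invariant, which needs
    -- goodness of rank a + 1, then `i` applications of δ at rank a + 1, each needing only goodness
    -- of rank a.
    induction i with
    | zero =>
      refine ⟨d ^ j * p, d' ^ j * p', ⟨?_, ?_, ?_⟩, ⟨?_, ?_, ?_⟩, ?_⟩
      · rw [map_mul, map_pow, hp.eq, ← hd.D_eq]; rfl
      · exact (hp.good.dickson_mul hd j).pred
      · have : a + numVars ((0, j) :: w) = a + 1 + numVars w := by simp [numVars]; omega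
        rw [this, map_mul, map_pow, hp.cutoff_eq, cutoff_mono (by omega) hdc]
      · rw [map_mul, map_pow, hp'.eq, ← hd'.D_eq]; rfl
      · exact (hp'.good.dickson_mul hd' j).pred
      · have : a + 1 + numVars ((0, j) :: w) = a + 1 + 1 + numVars w := by simp [numVars]; omega
        rw [this, map_mul, map_pow, hp'.cutoff_eq, cutoff_mono (by omega) hdc']
      · simp only [map_mul, map_pow, hdd, hpp]
        ring
    | succ i ihi =>
      obtain ⟨f, f', hf, hf', hff⟩ := ihi
      obtain ⟨g, hg, hg2⟩ := hf.delta (by omega)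
      obtain ⟨g', hg', hg2'⟩ := hf'.delta (by omega)
      refine ⟨g, g', ?_, ?_, hg.killVar_eq hg' hff⟩
      · have : a + numVars ((i + 1, j) :: w) = a + numVars ((i, j) :: w) + 1 := by
          simp [numVars]; omega
        rw [this]
        simpa only [Yfrom, Function.iterate_succ_apply'] using hg2
      · have : a + 1 + numVars ((i + 1, j) :: w) = a + 1 + numVars ((i, j) :: w) + 1 := by
          simp [numVars]; omega
        rw [this]
        simpa only [Yfrom, Function.iterate_succ_apply'] using hg2'

theorem numVars_of_mem_words (q m n : ℕ) : ∀ w ∈ words q m n, numVars w = n := by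
  induction n generalizing m with
  | zero => simp [words]
  | succ n ih =>
    intro w hw
    match m, n, ih, hw with
    | 0, n, _, hw =>
      have : w = [(n, 0)] := by simpa [words] using hw
      simp [this, numVars]
    | m + 1, 0, _, hw => obtain ⟨a, -, rfl⟩ := hw; simp [numVars]
    | m + 1, n + 1, ih, hw =>
      rcases hw with ⟨v, hv, rfl⟩ | ⟨a, -, v, hv, rfl⟩
      · have h0 := words_ne_nil _ _ _ v hv
        have h1 := ih _ v hv
        cases v with
        | nil => exact absurd rfl h0
        | cons p v => simp [incHead, numVars] at h1 ⊢; omega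
      · have h1 := ih _ v hv
        simp [numVars] at h1 ⊢
        omega

end

section

/-! ### Borel invariance -/

section

variable {K : Type*} [Field K]

/-- The ideal generated by all `x_i^Q`. -/
def powIdeal (K : Type*) [Field K] (Q : ℕ) : Ideal (MvPolynomial ℕ K) :=
  Ideal.span (Set.range fun i => X i ^ Q)

theorem X_pow_mem_powIdeal (Q i : ℕ) : X i ^ Q ∈ powIdeal K Q := Ideal.subset_span ⟨i, rfl⟩

theorem map_mem_of_mem_powIdeal {A : Type*} [CommRing A] [Algebra K A] {Q : ℕ} (I : Ideal A)
    (φ : MvPolynomial ℕ K →ₐ[K] A) (h : ∀ i, φ (X i) ^ Q ∈ I) {f : MvPolynomial ℕ K}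
    (hf : f ∈ powIdeal K Q) : φ f ∈ I := by
  have hle : powIdeal K Q ≤ I.comap φ.toRingHom := by
    unfold powIdeal
    rw [Ideal.span_le]
    rintro _ ⟨j, rfl⟩
    change φ (X j ^ Q) ∈ I
    rw [map_pow]
    exact h j
  exact hle hf

/-- Restriction of polynomials to the first `n` variables. -/
def restr (n : ℕ) : MvPolynomial ℕ K →ₐ[K] MvPolynomial (Fin n) K :=
  aeval fun i => if h : i < n then X ⟨i, h⟩ else 0

theorem restr_rename (n : ℕ) (p : MvPolynomial (Fin n) K) : restr n (rename Fin.val p) = p := by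
  refine DFunLike.congr_fun (?_ : (restr n).comp (rename Fin.val) = AlgHom.id K _) p
  ext i : 1
  simp [restr]

theorem rename_restr (n : ℕ) (p : MvPolynomial ℕ K) :
    rename Fin.val (restr n p) = cutoff n p := by
  refine DFunLike.congr_fun (?_ : (rename Fin.val).comp (restr n) = cutoff n) p
  ext i : 1
  simp only [restr, cutoff, AlgHom.comp_apply, aeval_X]
  split_ifs <;> simp

theorem C_mul_X_pow_mem (Q i : ℕ) (c : K) : (C c * X i) ^ Q ∈ powIdeal K Q := by
  rw [mul_pow]
  exact Ideal.mul_mem_left _ _ (X_pow_mem_powIdeal _ _)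

theorem update_pow_mem {Q t : ℕ} {y : MvPolynomial ℕ K} (hy : y ^ Q ∈ powIdeal K Q) (i : ℕ) :
    aeval (Function.update X t y) (X i : MvPolynomial ℕ K) ^ Q ∈ powIdeal K Q := by
  rw [aeval_X]
  by_cases h : i = t
  · subst h; simpa using hy
  · simpa [h] using X_pow_mem_powIdeal Q i

theorem aeval_linComb_of_lt {l t : ℕ} (hl : l ≤ t) (c : ℕ → K) (s : ℕ → MvPolynomial ℕ K)
    (hs : ∀ i < t, s i = X i) :
    aeval s (∑ k ∈ Finset.range l, C (c k) * X k) = ∑ k ∈ Finset.range l, C (c k) * X k := by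
  rw [map_sum]
  refine Finset.sum_congr rfl fun k hk => ?_
  have : k < t := (Finset.mem_range.mp hk).trans_le hl
  simp [hs k this]

theorem diag_ne_zero_of_mem_borelSubgroup {n : ℕ} {σ : GL (Fin n) K}
    (hσ : σ ∈ borelSubgroup K n) (i : Fin n) : σ.1 i i ≠ 0 := by
  have h : Matrix.BlockTriangular σ.1 id := fun i j h => hσ i j h
  have hd : σ.1.det ≠ 0 := ((Matrix.isUnit_iff_isUnit_det _).mp σ.isUnit).ne_zero
  rw [Matrix.det_of_isUpperTriangular h] at hd
  exact Finset.prod_ne_zero_iff.mp hd i (Finset.mem_univ i)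

end

variable {K : Type*} [Field K] [Fintype K]

theorem linComb_pow_mem (b : ℕ) {ι : Type*} (t : Finset ι) (c : ι → K) (k : ι → ℕ) :
    (∑ i ∈ t, C (c i) * X (k i)) ^ Fintype.card K ^ b ∈ powIdeal K (Fintype.card K ^ b) := by
  rw [frob_sum]
  refine Ideal.sum_mem _ fun i _ => ?_
  rw [mul_pow]
  exact Ideal.mul_mem_left _ _ (X_pow_mem_powIdeal _ _)

theorem add_pow_mem (b : ℕ) {f g : MvPolynomial ℕ K}
    (hf : f ^ Fintype.card K ^ b ∈ powIdeal K (Fintype.card K ^ b))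
    (hg : g ^ Fintype.card K ^ b ∈ powIdeal K (Fintype.card K ^ b)) :
    (f + g) ^ Fintype.card K ^ b ∈ powIdeal K (Fintype.card K ^ b) := by
  rw [frob_add]
  exact Ideal.add_mem _ hf hg

/-- The terms c_k x_k are added one shear at a time. Each shear preserves the ideal of Q-th powers
because Q-th powers are additive. -/
theorem Good.add_linComb_sub_mem {r b : ℕ} {f : MvPolynomial ℕ K}
    (hf : Good r (Fintype.card K ^ b) f) {l t : ℕ} (hl : l ≤ t) (c : ℕ → K) :
    aeval (Function.update X t (X t + ∑ k ∈ Finset.range l, C (c k) * X k)) f - f ∈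
      powIdeal K (Fintype.card K ^ b) := by
  induction l with
  | zero => simp
  | succ l ih =>
    have h1 := map_mem_of_mem_powIdeal _ (shear t l (c l)) (fun i => update_pow_mem
      (add_pow_mem b (X_pow_mem_powIdeal _ _) (C_mul_X_pow_mem _ _ _)) i) (ih (by omega))
    have h2 : shear t l (c l) f - f ∈ powIdeal K (Fintype.card K ^ b) :=
      Ideal.mem_of_dvd _ (hf.shear_sub t l (by omega) (c l)) (X_pow_mem_powIdeal _ _)
    have h3 : (shear t l (c l)).comp
        (aeval (Function.update X t (X t + ∑ k ∈ Finset.range l, C (c k) * X k))) =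
        aeval (Function.update X t (X t + ∑ k ∈ Finset.range (l + 1), C (c k) * X k)) := by
      ext i : 1
      by_cases hi : i = t
      · subst hi
        have := aeval_linComb_of_lt (show l ≤ i by omega) c
          (Function.update X i (X i + C (c l) * X l)) (fun j hj => by simp [hj.ne])
        simp only [shear, AlgHom.comp_apply, aeval_X, Function.update_self, map_add, this,
          Finset.sum_range_succ]
        ring
      · simp [shear, hi]
    rw [← h3, AlgHom.comp_apply]
    have := Ideal.add_mem _ h1 h2
    rwa [map_sub, sub_add_sub_cancel] at this

theorem Good.update_sub_mem {r b : ℕ} {f : MvPolynomial ℕ K}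
    (hf : Good r (Fintype.card K ^ b) f) (t : ℕ) {u : K} (hu : u ≠ 0) (c : ℕ → K) :
    aeval (Function.update X t (C u * X t + ∑ k ∈ Finset.range t, C (c k) * X k)) f - f ∈
      powIdeal K (Fintype.card K ^ b) := by
  -- The substitution is a scaling of x_t, under which `f` is exactly invariant, followed by a
  -- unipotent one; the scaling accounts for the factor u⁻¹.
  have h1 := hf.add_linComb_sub_mem le_rfl (fun k => u⁻¹ * c k) (t := t)
  have h2 := hf.diag_eq (Function.update 1 t u) fun i => by
    by_cases hi : i = t
    · subst hi; simpa using hu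
    · simp [hi]
  have h3 : (aeval (Function.update X t
        (X t + ∑ k ∈ Finset.range t, C (u⁻¹ * c k) * X k))).comp (diag (Function.update 1 t u)) =
      aeval (Function.update X t (C u * X t + ∑ k ∈ Finset.range t, C (c k) * X k)) := by
    ext i : 1
    by_cases hi : i = t
    · subst hi
      simp only [diag, AlgHom.comp_apply, aeval_X, Function.update_self, map_mul, aeval_C,
        mul_add, Finset.mul_sum]
      congr 1
      refine Finset.sum_congr rfl fun k _ => ?_
      have : (C u * C (u⁻¹ * c k) : MvPolynomial ℕ K) = C (c k) := by
        rw [← C_mul, mul_inv_cancel_left₀ hu]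
      rw [algebraMap_eq, ← mul_assoc, ← C_mul, this]
    · simp [diag, hi]
  rwa [← h3, AlgHom.comp_apply, h2]

/-- A triangular substitution is a composite of substitutions in one variable: the images of x_0, …,
x_{n-1} do not involve x_n, so the change of x_n leaves them alone. -/
theorem Good.triangular_sub_mem {r b : ℕ} {f : MvPolynomial ℕ K}
    (hf : Good r (Fintype.card K ^ b) f) (u : ℕ → K) (hu : ∀ t, u t ≠ 0) (c : ℕ → ℕ → K) (n : ℕ) :
    aeval (fun t => if t < n then C (u t) * X t + ∑ k ∈ Finset.range t, C (c t k) * X k else X t)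
      f - f ∈ powIdeal K (Fintype.card K ^ b) := by
  induction n with
  | zero => simp
  | succ n ih =>
    have h1 := map_mem_of_mem_powIdeal (powIdeal K (Fintype.card K ^ b)) (aeval (Function.update X n
      (C (u n) * X n + ∑ k ∈ Finset.range n, C (c n k) * X k))) (fun i => update_pow_mem
      (add_pow_mem b (C_mul_X_pow_mem _ _ _) (linComb_pow_mem b _ _ _)) i) ih
    have h2 := hf.update_sub_mem n (hu n) (c n)
    have h3 : (aeval (Function.update X n
        (C (u n) * X n + ∑ k ∈ Finset.range n, C (c n k) * X k))).comp (aeval fun t =>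
          if t < n then C (u t) * X t + ∑ k ∈ Finset.range t, C (c t k) * X k else X t) =
        aeval (fun t => if t < n + 1 then
          C (u t) * X t + ∑ k ∈ Finset.range t, C (c t k) * X k else X t) := by
      ext i : 1
      rcases lt_trichotomy i n with hi | rfl | hi
      · have := aeval_linComb_of_lt hi.le (c i) (Function.update X n
          (C (u n) * X n + ∑ k ∈ Finset.range n, C (c n k) * X k))
          (fun j hj => by simp [hj.ne])
        simp only [AlgHom.comp_apply, aeval_X, hi, hi.trans (Nat.lt_succ_self n), if_true,
          map_add, this]
        simp [hi.ne]
      · simp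
      · have hi' : ¬ i < n + 1 := by omega
        simp only [AlgHom.comp_apply, aeval_X, hi.not_gt, hi', if_false,
          Function.update_of_ne hi.ne']
    rw [← h3, AlgHom.comp_apply]
    have := Ideal.add_mem _ h1 h2
    rwa [map_sub, sub_add_sub_cancel] at this

/-- `p` is invariant under the Borel subgroup modulo the ideal `truncIdeal`. -/
def BorelInv (b n : ℕ) (p : MvPolynomial (Fin n) K) : Prop :=
  ∀ σ ∈ borelSubgroup K n, linSubst σ p - p ∈ truncIdeal K b n

theorem Good.borelInv {r b : ℕ} {f : MvPolynomial ℕ K} (hf : Good r (Fintype.card K ^ b) f)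
    {n : ℕ} {p : MvPolynomial (Fin n) K} (hp : rename Fin.val p = f) : BorelInv b n p := by
  intro σ hσ
  -- The transpose of `σ`, extended by the identity so that all diagonal entries are nonzero.
  let c : ℕ → ℕ → K := fun t k =>
    if h : k < n ∧ t < n then σ.1 ⟨k, h.1⟩ ⟨t, h.2⟩ else if k = t then 1 else 0
  have hc : ∀ t, c t t ≠ 0 := by
    intro t
    simp only [c]
    split_ifs with h
    · exact diag_ne_zero_of_mem_borelSubgroup hσ _
    · simp
  have h1 := hf.triangular_sub_mem (fun t => c t t) hc c n
  have h2 : (rename Fin.val).comp (linSubst σ) = (aeval fun t =>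
      if t < n then C (c t t) * X t + ∑ k ∈ Finset.range t, C (c t k) * X k else X t).comp
        (rename Fin.val : _ →ₐ[K] MvPolynomial ℕ K) := by
    ext j : 1
    have hs : ∀ i : Fin n, (C (σ.1 i j) * X (i : ℕ) : MvPolynomial ℕ K) =
        C (c j i) * X (i : ℕ) := by
      intro i
      simp [c]
    simp only [linSubst, AlgHom.comp_apply, aeval_X, map_sum, map_mul, rename_C, rename_X, hs,
      j.2, if_true]
    rw [Fin.sum_univ_eq_sum_range (fun i => (C (c j i) * X i : MvPolynomial ℕ K)),
      add_comm, ← Finset.sum_range_succ (fun k => (C (c j k) * X k : MvPolynomial ℕ K))]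
    symm
    refine Finset.sum_subset (by simp) fun i hi hij => ?_
    have hi' : i < n := by simpa using hi
    have hij' : (j : ℕ) < i := by simp at hij; omega
    have : c j i = 0 := by
      simp only [c, hi', j.2, and_self, dif_pos]
      exact hσ ⟨i, hi'⟩ j hij'
    simp [this]
  have h3 := DFunLike.congr_fun h2 p
  simp only [AlgHom.comp_apply, hp] at h3
  rw [← h3] at h1
  have h4 := map_mem_of_mem_powIdeal (truncIdeal K b n) (restr n) (fun i => ?_) h1
  · rwa [map_sub, ← hp, restr_rename, restr_rename] at h4
  · simp only [restr, aeval_X]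
    split_ifs with h
    · exact Ideal.subset_span ⟨_, rfl⟩
    · rw [zero_pow (pow_ne_zero _ Fintype.card_ne_zero)]
      exact Ideal.zero_mem _

end

section

/-! ### The truncation ideal and coefficients with respect to the first variable -/

section

variable {K : Type*} [Field K]

/-- The coefficient of `x_0^k`, a polynomial in the other variables. -/
def xCoeff {n : ℕ} (k : ℕ) : MvPolynomial (Fin (n + 1)) K →ₗ[K] MvPolynomial (Fin n) K :=
  (Polynomial.lcoeff (MvPolynomial (Fin n) K) k).restrictScalars K ∘ₗ
    (finSuccEquiv K n).toLinearMap

theorem xCoeff_apply {n : ℕ} (k : ℕ) (f : MvPolynomial (Fin (n + 1)) K) :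
    xCoeff k f = (finSuccEquiv K n f).coeff k := rfl

theorem finSuccEquiv_rename_succ {n : ℕ} (f : MvPolynomial (Fin n) K) :
    finSuccEquiv K n (rename Fin.succ f) = Polynomial.C f := by
  refine DFunLike.congr_fun (?_ : (finSuccEquiv K n).toAlgHom.comp (rename Fin.succ) =
    (IsScalarTower.toAlgHom K (MvPolynomial (Fin n) K) (Polynomial (MvPolynomial (Fin n) K)))) f
  ext i : 1
  simp [finSuccEquiv_X_succ, Polynomial.algebraMap_eq]

/-- A matrix in the Borel subgroup from its entries. -/
theorem exists_mem_borelSubgroup {n : ℕ} (A : Matrix (Fin n) (Fin n) K)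
    (h : ∀ i j, j < i → A i j = 0) (hd : ∀ i, A i i ≠ 0) :
    ∃ σ ∈ borelSubgroup K n, σ.1 = A := by
  have hA : A.det ≠ 0 := by
    rw [Matrix.det_of_isUpperTriangular (M := A) fun i j hij => h i j hij]
    exact Finset.prod_ne_zero_iff.mpr fun i _ => hd i
  exact ⟨Matrix.GeneralLinearGroup.mkOfDetNeZero A hA, fun i j hij => h i j hij, rfl⟩

theorem exists_scale_first (n : ℕ) {c : K} (hc : c ≠ 0) :
    ∃ σ ∈ borelSubgroup K (n + 1), ∀ (f : MvPolynomial (Fin (n + 1)) K) (k : ℕ),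
      xCoeff k (linSubst σ f) = C c ^ k * xCoeff k f := by
  obtain ⟨σ, hσ, hA⟩ := exists_mem_borelSubgroup
    (Matrix.diagonal (Fin.cons c fun _ => 1) : Matrix (Fin (n + 1)) (Fin (n + 1)) K)
    (fun i j hij => Matrix.diagonal_apply_ne _ hij.ne')
    (fun i => by refine Fin.cases ?_ (fun i => ?_) i <;> simp [hc])
  refine ⟨σ, hσ, fun f k => ?_⟩
  have h : ((finSuccEquiv K n).toAlgHom.comp (linSubst σ)) =
      ((Polynomial.aeval (R := MvPolynomial (Fin n) K)
        (Polynomial.C (C c) * Polynomial.X : Polynomial (MvPolynomial (Fin n) K))).restrictScalars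
          K).comp (finSuccEquiv K n).toAlgHom := by
    ext j : 1
    refine Fin.cases ?_ (fun j => ?_) j
    · simp [linSubst, hA, Matrix.diagonal_apply, Fin.sum_univ_succ, Fin.succ_ne_zero,
        finSuccEquiv_apply]
    · simp [linSubst, hA, Matrix.diagonal_apply, Fin.sum_univ_succ, (Fin.succ_ne_zero _).symm,
        finSuccEquiv_apply]
  have h1 := DFunLike.congr_fun h f
  change finSuccEquiv K n (linSubst σ f) = Polynomial.aeval _ (finSuccEquiv K n f) at h1
  rw [xCoeff_apply, h1, xCoeff_apply, ← Polynomial.comp_eq_aeval, Polynomial.comp_C_mul_X_coeff,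
    mul_comm]

theorem exists_extend_borel {n : ℕ} {σ : GL (Fin n) K} (hσ : σ ∈ borelSubgroup K n) :
    ∃ τ ∈ borelSubgroup K (n + 1), ∀ (f : MvPolynomial (Fin (n + 1)) K) (k : ℕ),
      xCoeff k (linSubst τ f) = linSubst σ (xCoeff k f) := by
  obtain ⟨τ, hτ, hA⟩ := exists_mem_borelSubgroup
    (Matrix.of fun i j => Fin.cases (Fin.cases 1 (fun _ => 0) j)
      (fun i => Fin.cases 0 (fun j => σ.1 i j) j) i : Matrix (Fin (n + 1)) (Fin (n + 1)) K)
    (fun i j hij => by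
      induction i using Fin.cases with
      | zero => exact absurd hij (Fin.not_lt_zero _)
      | succ i =>
        induction j using Fin.cases with
        | zero => rfl
        | succ j => exact hσ i j (by simpa using hij))
    (fun i => by
      induction i using Fin.cases with
      | zero => simp
      | succ i => exact diag_ne_zero_of_mem_borelSubgroup hσ i)
  refine ⟨τ, hτ, fun f k => ?_⟩
  have h : ((finSuccEquiv K n).toAlgHom.comp (linSubst τ)) =
      (Polynomial.mapAlgHom (linSubst σ)).comp (finSuccEquiv K n).toAlgHom := by
    ext j : 1
    refine Fin.cases ?_ (fun j => ?_) j
    · simp [linSubst, hA, Fin.sum_univ_succ, finSuccEquiv_X_zero]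
    · simp [linSubst, hA, Fin.sum_univ_succ, finSuccEquiv_apply]
  have h1 := DFunLike.congr_fun h f
  change finSuccEquiv K n (linSubst τ f) = Polynomial.map _ (finSuccEquiv K n f) at h1
  rw [xCoeff_apply, h1, Polynomial.coeff_map]
  rfl

/-- The substitution `x_j ↦ x_j + t`, where `t` is the variable of the polynomial ring. -/
def translate {n : ℕ} (j : Fin n) :
    MvPolynomial (Fin n) K →ₐ[K] Polynomial (MvPolynomial (Fin n) K) :=
  aeval fun i => if i = j then Polynomial.X + Polynomial.C (X i) else Polynomial.C (X i)

theorem coeff_zero_translate {n : ℕ} (j : Fin n) (f : MvPolynomial (Fin n) K) :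
    (translate j f).coeff 0 = f := by
  have h : ((Polynomial.aeval (R := MvPolynomial (Fin n) K)
      (0 : MvPolynomial (Fin n) K)).restrictScalars K).comp (translate j) =
      AlgHom.id K (MvPolynomial (Fin n) K) := by
    ext i : 1
    by_cases hi : i = j <;> simp [translate, hi]
  have := DFunLike.congr_fun h f
  rwa [AlgHom.comp_apply, AlgHom.restrictScalars_apply, Polynomial.coe_aeval_eq_eval,
    ← Polynomial.coeff_zero_eq_eval_zero] at this

/-- The transvection x_{j+1} ↦ x_{j+1} + x_0 is upper triangular. Viewed in x_0, it translates each
coefficient by the polynomial variable. -/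
theorem exists_add_first {n : ℕ} (j : Fin n) :
    ∃ σ ∈ borelSubgroup K (n + 1), ∀ f : MvPolynomial (Fin (n + 1)) K,
      finSuccEquiv K n (linSubst σ f) =
        (finSuccEquiv K n f).eval₂ (translate j).toRingHom Polynomial.X := by
  obtain ⟨σ, hσ, hA⟩ := exists_mem_borelSubgroup
    (Matrix.transvection 0 j.succ 1 : Matrix (Fin (n + 1)) (Fin (n + 1)) K)
    (fun a b hab => by
      have h1 : ¬ (0 = a ∧ j.succ = b) := by
        rintro ⟨rfl, -⟩
        exact Fin.not_lt_zero _ hab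
      simp [Matrix.transvection, hab.ne', h1])
    (fun a => by
      have h1 : ¬ (0 = a ∧ j.succ = a) := by
        rintro ⟨rfl, h⟩
        exact Fin.succ_ne_zero _ h
      simp [Matrix.transvection, h1])
  refine ⟨σ, hσ, fun f => ?_⟩
  have hX : ∀ i, linSubst σ (X i) = X i + if j.succ = i then X 0 else 0 := by
    intro i
    have hC : ∀ a, (C ((Matrix.transvection 0 j.succ 1 : Matrix _ _ K) a i) * X a :
        MvPolynomial (Fin (n + 1)) K) =
          (if a = i then X a else 0) + if 0 = a then (if j.succ = i then X a else 0) else 0 := by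
      intro a
      by_cases h1 : a = i <;> by_cases h2 : 0 = a <;> by_cases h3 : j.succ = i <;>
        simp [Matrix.transvection, Matrix.single_apply, h1, h2, h3, add_mul]
    simp only [linSubst, aeval_X, hA, hC, Finset.sum_add_distrib]
    simp
  have h : ((finSuccEquiv K n).toAlgHom.comp (linSubst σ)).toRingHom =
      (Polynomial.eval₂RingHom (translate j).toRingHom Polynomial.X).comp
        (finSuccEquiv K n).toAlgHom.toRingHom := by
    refine MvPolynomial.ringHom_ext (fun r => ?_) fun i => ?_
    · simp [linSubst, finSuccEquiv_apply, translate, algebraMap_eq]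
    · change finSuccEquiv K n (linSubst σ (X i)) = Polynomial.eval₂ _ _ (finSuccEquiv K n (X i))
      rw [hX]
      induction i using Fin.cases with
      | zero => simp [finSuccEquiv_X_zero, Fin.succ_ne_zero]
      | succ i =>
        by_cases hij : i = j
        · subst hij
          simp [finSuccEquiv_X_zero, finSuccEquiv_X_succ, translate, add_comm]
        · have hji : ¬ j = i := fun h => hij h.symm
          simp [finSuccEquiv_X_succ, translate, hij, hji]
  exact DFunLike.congr_fun h f

/-- The coefficient of t^v in f(x_j + t) is the v-th Hasse derivative, whence the binomial
coefficient. -/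
theorem coeff_translate {n : ℕ} (j : Fin n) (v : ℕ) (β : Fin n →₀ ℕ) (hv : v ≤ β j)
    (f : MvPolynomial (Fin n) K) :
    coeff (β - Finsupp.single j v) ((translate j f).coeff v) = (β j).choose v * coeff β f := by
  induction f using MvPolynomial.induction_on' with
  | add p q hp hq => simp only [map_add, Polynomial.coeff_add, coeff_add, hp, hq, mul_add]
  | monomial γ a =>
    have h1 : translate j (monomial γ a) =
        (Polynomial.X + Polynomial.C (X j)) ^ γ j * Polynomial.C (monomial (γ.erase j) a) := by
      rw [translate, aeval_monomial, Finsupp.prod_fintype _ _ (by simp),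
        Fintype.prod_eq_mul_prod_compl j, if_pos rfl, monomial_eq,
        Finsupp.prod_fintype _ _ (by simp), Fintype.prod_eq_mul_prod_compl j]
      have : ∏ i ∈ ({j} : Finset (Fin n))ᶜ, (if i = j then Polynomial.X + Polynomial.C (X i)
          else Polynomial.C (X i : MvPolynomial (Fin n) K)) ^ γ i =
          Polynomial.C (∏ i ∈ ({j} : Finset (Fin n))ᶜ, X i ^ (γ.erase j) i) := by
        rw [map_prod]
        refine Finset.prod_congr rfl fun i hi => ?_
        have : i ≠ j := by simpa using hi
        simp [this]
      rw [this]
      simp only [Finsupp.erase_same, pow_zero, one_mul, map_mul]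
      rw [IsScalarTower.algebraMap_apply K (MvPolynomial (Fin n) K), Polynomial.algebraMap_eq,
        algebraMap_eq]
      ring
    rw [h1, Polynomial.coeff_mul_C, Polynomial.coeff_X_add_C_pow, coeff_monomial]
    have h2 : (X j ^ (γ j - v) * ((γ j).choose v : MvPolynomial (Fin n) K) *
        monomial (γ.erase j) a) =
        monomial (Finsupp.single j (γ j - v) + γ.erase j) ((γ j).choose v * a) := by
      rw [X_pow_eq_monomial, ← map_natCast C, mul_comm (monomial _ _), C_mul_monomial,
        monomial_mul, mul_one]
    rw [h2, coeff_monomial]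
    by_cases hγ : γ = β
    · subst hγ
      have : Finsupp.single j (γ j - v) + γ.erase j = γ - Finsupp.single j v := by
        ext i
        by_cases hi : i = j
        · subst hi; simp
        · simp [hi]
      rw [if_pos this, if_pos rfl]
    · rw [if_neg hγ, mul_zero]
      split_ifs with h3
      -- Distinct exponents can agree after truncated subtraction only when γ_j < v, and then the
      -- binomial coefficient is zero.
      · have hlt : γ j < v := by
          by_contra hle
          apply hγ
          ext i
          have := DFunLike.congr_fun h3 i
          by_cases hi : i = j
          · subst hi; simp at this; omega
          · have h4 : ¬ j = i := fun h => hi h.symm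
            simpa [hi, Finsupp.single_apply, h4] using this
        simp [Nat.choose_eq_zero_of_lt hlt]
      · rfl

end

variable {K : Type*} [Field K] [Fintype K]

/-! ### Exponent description of the truncation ideal, and Frobenius. -/

theorem mem_truncIdeal_iff {m n : ℕ} {f : MvPolynomial (Fin n) K} :
    f ∈ truncIdeal K m n ↔
      ∀ β : Fin n →₀ ℕ, (∀ i, β i < Fintype.card K ^ m) → coeff β f = 0 := by
  have h : truncIdeal K m n = Ideal.span ((fun s => monomial s (1 : K)) ''
      Set.range fun i : Fin n => Finsupp.single i (Fintype.card K ^ m)) := by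
    rw [truncIdeal, ← Set.range_comp]
    congr 2
    ext i : 1
    simp [X_pow_eq_monomial]
  rw [h, mem_ideal_span_monomial_image]
  constructor
  · intro hf β hβ
    by_contra hne
    obtain ⟨_, ⟨i, rfl⟩, hi⟩ := hf β (mem_support_iff.mpr hne)
    have := hi i
    simp only [Finsupp.single_eq_same] at this
    exact absurd (hβ i) (not_lt.mpr this)
  · intro hf β hβ
    by_contra hne
    refine mem_support_iff.mp hβ (hf β fun i => ?_)
    by_contra hi
    exact hne ⟨_, ⟨i, rfl⟩, Finsupp.single_le_iff.mpr (not_lt.mp hi)⟩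

theorem mem_truncIdeal_succ_iff {m n : ℕ} {f : MvPolynomial (Fin (n + 1)) K} :
    f ∈ truncIdeal K m (n + 1) ↔
      ∀ k < Fintype.card K ^ m, xCoeff k f ∈ truncIdeal K m n := by
  simp only [mem_truncIdeal_iff, xCoeff_apply, finSuccEquiv_coeff_coeff]
  constructor
  · intro h k hk β hβ
    refine h _ fun i => ?_
    refine Fin.cases ?_ (fun i => ?_) i
    · simpa using hk
    · simpa using hβ i
  · intro h β hβ
    rw [← Finsupp.cons_tail β]
    exact h _ (hβ 0) _ fun i => hβ i.succ

/-- The Frobenius endomorphism `f ↦ f^q`. -/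
def frob (K : Type*) [Field K] [Fintype K] (n : ℕ) :
    MvPolynomial (Fin n) K →ₐ[K] MvPolynomial (Fin n) K :=
  FiniteField.frobeniusAlgHom K _

theorem frob_apply {n : ℕ} (f : MvPolynomial (Fin n) K) : frob K n f = f ^ Fintype.card K := rfl

theorem frob_eq_expand (n : ℕ) : frob K n = expand (Fintype.card K) := by
  ext i : 1
  simp [frob_apply]

theorem linSubst_frob {n : ℕ} (σ : GL (Fin n) K) (f : MvPolynomial (Fin n) K) :
    linSubst σ (frob K n f) = frob K n (linSubst σ f) := by
  rw [frob_apply, frob_apply, map_pow]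

/-- Over 𝔽_q, Frobenius multiplies all exponents by q, so the bound q^m becomes q^{m+1}. -/
theorem frob_mem_truncIdeal_iff {m n : ℕ} {f : MvPolynomial (Fin n) K} :
    frob K n f ∈ truncIdeal K (m + 1) n ↔ f ∈ truncIdeal K m n := by
  have hq : 0 < Fintype.card K := Fintype.card_pos
  rw [frob_eq_expand, mem_truncIdeal_iff, mem_truncIdeal_iff]
  constructor
  · intro h β hβ
    have := h (Fintype.card K • β) fun i => by
      rw [Finsupp.smul_apply, smul_eq_mul, pow_succ']
      exact Nat.mul_lt_mul_of_pos_left (hβ i) hq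
    rwa [coeff_expand_smul _ hq.ne'] at this
  · intro h β hβ
    by_cases hd : ∀ i, Fintype.card K ∣ β i
    · have hβ' : β = Fintype.card K • β.mapRange (· / Fintype.card K) (Nat.zero_div _) := by
        ext i
        simp [Nat.mul_div_cancel' (hd i)]
      rw [hβ', coeff_expand_smul _ hq.ne']
      refine h _ fun i => ?_
      rw [Finsupp.mapRange_apply]
      exact Nat.div_lt_of_lt_mul (by rw [← pow_succ']; exact hβ i)
    · push Not at hd
      obtain ⟨i, hi⟩ := hd
      exact coeff_expand_of_not_dvd _ hi

/-! ### Constraints on the coefficients of an invariant. -/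

theorem BorelInv.xCoeff {b n : ℕ} {f : MvPolynomial (Fin (n + 1)) K} (hf : BorelInv b (n + 1) f)
    {k : ℕ} (hk : k < Fintype.card K ^ b) : BorelInv b n (xCoeff k f) := by
  intro σ hσ
  obtain ⟨τ, hτ, h⟩ := exists_extend_borel hσ
  rw [← h, ← map_sub]
  exact mem_truncIdeal_succ_iff.mp (hf τ hτ) k hk

/-- Scaling x_0 by a generator ζ of the cyclic group 𝔽_q^× multiplies the coefficient by ζ^k, and
ζ^k - 1 is invertible unless q - 1 divides k. -/
theorem BorelInv.xCoeff_mem {b n : ℕ} {f : MvPolynomial (Fin (n + 1)) K}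
    (hf : BorelInv b (n + 1) f) {k : ℕ} (hk : k < Fintype.card K ^ b)
    (hd : ¬ Fintype.card K - 1 ∣ k) : Borel.xCoeff k f ∈ truncIdeal K b n := by
  obtain ⟨ζ, hζ⟩ := IsCyclic.exists_generator (α := Kˣ)
  have hord : orderOf ζ = Fintype.card K - 1 := by
    rw [orderOf_eq_card_of_forall_mem_zpowers hζ, Nat.card_units, Nat.card_eq_fintype_card]
  obtain ⟨σ, hσ, h⟩ := exists_scale_first n ζ.ne_zero
  have h1 := mem_truncIdeal_succ_iff.mp (hf σ hσ) k hk
  rw [map_sub, h, ← sub_one_mul, ← C_pow, ← C_1, ← C_sub] at h1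
  have hne : ((ζ : K) ^ k - 1) ≠ 0 := by
    intro h0
    apply hd
    rw [← hord]
    refine orderOf_dvd_of_pow_eq_one (Units.ext ?_)
    simpa using sub_eq_zero.mp h0
  have h2 := Ideal.mul_mem_left _ (C ((ζ : K) ^ k - 1)⁻¹) h1
  rwa [← mul_assoc, ← C_mul, inv_mul_cancel₀ hne, C_1, one_mul] at h2

theorem coeff_translate_mem {b n : ℕ} (j : Fin n) {g : MvPolynomial (Fin n) K}
    (hg : g ∈ truncIdeal K b n) {s : ℕ} (hs : s < Fintype.card K ^ b) :
    (translate j g).coeff s ∈ truncIdeal K b n := by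
  obtain ⟨σ, hσ, h⟩ := exists_add_first (K := K) j
  -- Regard `g` as free of x_0: the transvection preserves the ideal, and the coefficients of the
  -- image in x_0 are those of the translate.
  have h1 : rename Fin.succ g ∈ truncIdeal K b (n + 1) := by
    rw [mem_truncIdeal_succ_iff]
    intro k hk
    rw [xCoeff_apply, finSuccEquiv_rename_succ, Polynomial.coeff_C]
    split_ifs
    · exact hg
    · exact Ideal.zero_mem _
  have h2 := mem_truncIdeal_succ_iff.mp (linSubst_mem K σ _ h1) s hs
  rwa [xCoeff_apply, h, finSuccEquiv_rename_succ, Polynomial.eval₂_C] at h2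

/-- As in Lucas' theorem, (X+1)^a = (X^q+1)^{a/q} (X+1)^{a mod q}. In degree a mod q < q only the
constant term of the first factor contributes. -/
theorem choose_mod_card (a : ℕ) : ((a.choose (a % Fintype.card K) : ℕ) : K) = 1 := by
  set q := Fintype.card K with hq
  have hv : a % q < q := Nat.mod_lt _ Fintype.card_pos
  have h1 : (Polynomial.X + 1 : Polynomial K) ^ a =
      (Polynomial.X ^ q + 1) ^ (a / q) * (Polynomial.X + 1) ^ (a % q) := by
    have := frob_add (K := K) (Polynomial.X : Polynomial K) 1 1
    rw [pow_one, one_pow] at this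
    rw [← this, ← pow_mul, ← pow_add, Nat.div_add_mod]
  obtain ⟨h, hh⟩ : ∃ h : Polynomial K, (Polynomial.X ^ q + 1) ^ (a / q) = 1 + Polynomial.X ^ q * h := by
    obtain ⟨h, hh⟩ := sub_dvd_pow_sub_pow (Polynomial.X ^ q + 1 : Polynomial K) 1 (a / q)
    exact ⟨h, by rw [one_pow, add_sub_cancel_right] at hh; rw [← hh]; ring⟩
  rw [← Polynomial.coeff_X_add_one_pow, h1, hh, add_mul, one_mul, Polynomial.coeff_add, mul_assoc,
    Polynomial.coeff_X_pow_mul', if_neg (not_le.mpr hv), Polynomial.coeff_X_add_one_pow]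
  simp

/-- Compare coefficients of x_0^{k+v} after x_{j+1} ↦ x_{j+1} + x_0. Contributions from exponents
below k vanish by assumption, those strictly between k and k + v since q - 1 does not divide them,
and exponent k + v contributes the unchanged coefficient. -/
theorem BorelInv.coeff_translate_mem {b n k v : ℕ} {f : MvPolynomial (Fin (n + 1)) K}
    (hf : BorelInv b (n + 1) f) (hk : Fintype.card K - 1 ∣ k)
    (hkb : k + (Fintype.card K - 1) < Fintype.card K ^ b)
    (hlow : ∀ l < k, Borel.xCoeff l f ∈ truncIdeal K b n) (j : Fin n) (hv0 : 0 < v)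
    (hv : v < Fintype.card K) : (translate j (Borel.xCoeff k f)).coeff v ∈ truncIdeal K b n := by
  obtain ⟨σ, hσ, h⟩ := exists_add_first (K := K) j
  have h1 := mem_truncIdeal_succ_iff.mp (hf σ hσ) (k + v) (by omega)
  set T := truncIdeal K b n
  set F := finSuccEquiv K n f with hF
  have h2 : (F.eval₂ (translate j).toRingHom Polynomial.X).coeff (k + v) =
      ∑ l ∈ Finset.range (F.natDegree + 1 + (k + v + 1)),
        if l ≤ k + v then (translate j (F.coeff l)).coeff (k + v - l) else 0 := by
    rw [Polynomial.eval₂_eq_sum_range' _ (n := F.natDegree + 1 + (k + v + 1)) (by omega),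
      Polynomial.finsetSum_coeff]
    refine Finset.sum_congr rfl fun l _ => ?_
    rw [Polynomial.coeff_mul_X_pow']
    rfl
  have hmem : ∀ l, l ≠ k → l ≠ k + v →
      (if l ≤ k + v then (translate j (F.coeff l)).coeff (k + v - l) else 0) ∈ T := by
    intro l hlk hlv
    split_ifs with hle
    · refine Borel.coeff_translate_mem j ?_ (by omega)
      rcases lt_or_gt_of_ne hlk with hlt | hgt
      · exact hlow l hlt
      · refine hf.xCoeff_mem (by omega) fun hd => ?_
        obtain ⟨d, hd'⟩ := (Nat.dvd_sub hd hk)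
        have : 0 < d := Nat.pos_of_ne_zero (by rintro rfl; omega)
        have : Fintype.card K - 1 ≤ l - k := hd' ▸ Nat.le_mul_of_pos_right _ this
        omega
    · exact Ideal.zero_mem _
  rw [map_sub, xCoeff_apply, h, xCoeff_apply, h2,
    ← Finset.add_sum_erase _ _ (show k ∈ Finset.range (F.natDegree + 1 + (k + v + 1)) by
      simp; omega),
    ← Finset.add_sum_erase _ _ (show k + v ∈
      (Finset.range (F.natDegree + 1 + (k + v + 1))).erase k by simp; omega)] at h1
  have h3 : (∑ l ∈ ((Finset.range (F.natDegree + 1 + (k + v + 1))).erase k).erase (k + v),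
      if l ≤ k + v then (translate j (F.coeff l)).coeff (k + v - l) else 0) ∈ T := by
    refine Ideal.sum_mem _ fun l hl => ?_
    simp only [Finset.mem_erase] at hl
    exact hmem l hl.2.1 hl.1
  rw [if_pos le_rfl, if_pos (Nat.le_add_right _ _), Nat.sub_self, coeff_zero_translate,
    Nat.add_sub_cancel_left] at h1
  have h4 := Ideal.sub_mem _ h1 h3
  convert h4 using 1
  rw [xCoeff_apply]
  ring

/-- The leading coefficient of an invariant is a `q`-th power of an invariant. -/
theorem BorelInv.exists_frob {b n k : ℕ} {f : MvPolynomial (Fin (n + 1)) K}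
    (hf : BorelInv (b + 1) (n + 1) f) (hk : Fintype.card K - 1 ∣ k)
    (hkb : k + (Fintype.card K - 1) < Fintype.card K ^ (b + 1))
    (hlow : ∀ l < k, Borel.xCoeff l f ∈ truncIdeal K (b + 1) n) :
    ∃ g, BorelInv b n g ∧ Borel.xCoeff k f - frob K n g ∈ truncIdeal K (b + 1) n := by
  set q := Fintype.card K with hq
  have hq0 : 0 < q := Fintype.card_pos
  set F := Borel.xCoeff k f with hF
  -- Taking v = β_j mod q makes the binomial coefficient equal to 1, so the coefficient itself must
  -- vanish: only exponents divisible by q survive.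
  have hsupp : ∀ β : Fin n →₀ ℕ, (∀ i, β i < q ^ (b + 1)) → (∃ j, ¬ q ∣ β j) → coeff β F = 0 := by
    rintro β hβ ⟨j, hj⟩
    have hv0 : 0 < β j % q := Nat.pos_of_ne_zero fun h => hj (Nat.dvd_of_mod_eq_zero h)
    have h1 := hf.coeff_translate_mem hk hkb hlow j hv0 (Nat.mod_lt _ hq0)
    have h2 := mem_truncIdeal_iff.mp h1 (β - Finsupp.single j (β j % q)) fun i =>
      (Nat.sub_le _ _).trans_lt (hβ i)
    rwa [coeff_translate j _ β (Nat.mod_le _ _), choose_mod_card, one_mul] at h2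
  let g : MvPolynomial (Fin n) K := ∑ β ∈ F.support.filter fun β => ∀ j, q ∣ β j,
    monomial (β.mapRange (· / q) (Nat.zero_div _)) (coeff β F)
  have hg : frob K n g = ∑ β ∈ F.support.filter fun β => ∀ j, q ∣ β j, monomial β (coeff β F) := by
    rw [frob_eq_expand, map_sum]
    refine Finset.sum_congr rfl fun β hβ => ?_
    have : q • β.mapRange (· / q) (Nat.zero_div _) = β := by
      ext i
      simp [Nat.mul_div_cancel' ((Finset.mem_filter.mp hβ).2 i)]
    rw [expand_monomial, this]
  have hFg : F - frob K n g ∈ truncIdeal K (b + 1) n := by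
    rw [mem_truncIdeal_iff]
    intro β hβ
    rw [coeff_sub, hg, coeff_sum]
    simp only [coeff_monomial, Finset.sum_ite_eq', Finset.mem_filter, mem_support_iff]
    by_cases hd : ∀ j, q ∣ β j
    · by_cases h0 : coeff β F = 0 <;> simp [hd, h0]
    · simp [hd, hsupp β hβ (by simpa using hd)]
  refine ⟨g, fun σ hσ => ?_, hFg⟩
  -- Frobenius commutes with the group action and reflects the truncation ideal, so invariance of
  -- the coefficient descends to its q-th root.
  rw [← frob_mem_truncIdeal_iff, map_sub, ← linSubst_frob]
  have h1 := hf.xCoeff (show k < q ^ (b + 1) by omega) σ hσ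
  have h2 := linSubst_mem K σ _ hFg
  have := Ideal.add_mem _ (Ideal.sub_mem _ h1 h2) hFg
  rw [map_sub] at this
  convert this using 1
  ring

end

section

/-! ### Bases modulo a subspace and filtrations -/

section Filtration

variable {K V V' V'' ι : Type*} [Field K] [AddCommGroup V] [Module K V] [AddCommGroup V']
  [Module K V'] [AddCommGroup V''] [Module K V'']

/-- The family `y`, restricted to `W`, induces a basis of `U / T`. -/
structure BasisMod (T U : Submodule K V) (W : Set ι) (y : ι → V) : Prop where
  mem : ∀ w ∈ W, y w ∈ U
  indep : ∀ c : ι →₀ K, (c.support : Set ι) ⊆ W → Finsupp.linearCombination K y c ∈ T → c = 0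
  span : ∀ f ∈ U, ∃ c : ι →₀ K, (c.support : Set ι) ⊆ W ∧ f - Finsupp.linearCombination K y c ∈ T

theorem linearCombination_mem {U : Submodule K V} {y : ι → V} {c : ι →₀ K}
    (h : ∀ w ∈ c.support, y w ∈ U) : Finsupp.linearCombination K y c ∈ U := by
  rw [Finsupp.linearCombination_apply]
  exact Submodule.sum_mem _ fun w hw => Submodule.smul_mem _ _ (h w hw)

/-- A triangularity argument: κ_a reads off the coefficient at level `a`, and members of higher
level are invisible to it. Independence follows by killing levels from the bottom, and spanning by
subtracting leading terms for a = 0, …, A. -/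
theorem BasisMod.of_filtration {T U : Submodule K V} {T' : Submodule K V'} {W : Set ι} {y : ι → V}
    (lev : ι → ℕ) (A : ℕ) (κ : ℕ → V →ₗ[K] V') (mem : ∀ w ∈ W, y w ∈ U)
    (hlev : ∀ w ∈ W, lev w ≤ A) (h1 : ∀ w ∈ W, ∀ a < lev w, κ a (y w) ∈ T')
    (h2 : ∀ a ≤ A, ∀ c : ι →₀ K, (c.support : Set ι) ⊆ W → (∀ i ∈ c.support, lev i = a) →
      κ a (Finsupp.linearCombination K y c) ∈ T' → c = 0)
    (h3 : ∀ a ≤ A, ∀ f ∈ U, (∀ a' < a, κ a' f ∈ T') → ∃ c : ι →₀ K, (c.support : Set ι) ⊆ W ∧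
      (∀ i ∈ c.support, lev i = a) ∧ κ a (f - Finsupp.linearCombination K y c) ∈ T')
    (h4 : ∀ f ∈ U, (∀ a ≤ A, κ a f ∈ T') → f ∈ T) (h5 : ∀ f ∈ T, ∀ a ≤ A, κ a f ∈ T') :
    BasisMod T U W y := by
  classical
  have low : ∀ (a : ℕ) (c : ι →₀ K), (c.support : Set ι) ⊆ W → (∀ i ∈ c.support, a < lev i) →
      κ a (Finsupp.linearCombination K y c) ∈ T' := by
    intro a c hc hl
    exact linearCombination_mem (U := T'.comap (κ a)) fun w hw => h1 w (hc hw) a (hl w hw)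
  refine ⟨mem, fun c hc hT => ?_, fun f hf => ?_⟩
  · have key : ∀ a i, lev i = a → c i = 0 := by
      intro a
      induction a using Nat.strong_induction_on with
      | _ a ih =>
        intro i hi
        by_contra hci
        have haA : a ≤ A := hi ▸ hlev i (hc (Finsupp.mem_support_iff.mpr hci))
        have hsum := c.filter_add_filter_not (fun j => lev j = a)
        have hhigh : κ a (Finsupp.linearCombination K y (c.filter fun j => ¬ lev j = a)) ∈ T' := by
          refine low _ _ ?_ fun j hj => ?_
          · rw [Finsupp.support_filter]
            exact (Finset.coe_subset.mpr (Finset.filter_subset _ _)).trans hc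
          · rw [Finsupp.support_filter, Finset.mem_filter, Finsupp.mem_support_iff] at hj
            by_contra hlt
            exact hj.1 (ih (lev j) (by omega) j rfl)
        have htot := h5 _ hT a haA
        rw [← hsum, map_add, map_add] at htot
        have h0 := h2 a haA (c.filter fun j => lev j = a) (by
          rw [Finsupp.support_filter]
          exact (Finset.coe_subset.mpr (Finset.filter_subset _ _)).trans hc) (fun j hj => by
          rw [Finsupp.support_filter, Finset.mem_filter] at hj
          exact hj.2) ((Submodule.add_mem_iff_left _ hhigh).mp htot)
        have := DFunLike.congr_fun h0 i
        rw [Finsupp.filter_apply_pos (fun j => lev j = a) c hi] at this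
        exact hci this
    ext i
    exact key _ i rfl
  · have key : ∀ t ≤ A + 1, ∃ c : ι →₀ K, (c.support : Set ι) ⊆ W ∧
        ∀ a < t, κ a (f - Finsupp.linearCombination K y c) ∈ T' := by
      intro t
      induction t with
      | zero => exact fun _ => ⟨0, by simp, by simp⟩
      | succ t ih =>
        intro ht
        obtain ⟨c, hc, hcl⟩ := ih (by omega)
        have hU : f - Finsupp.linearCombination K y c ∈ U :=
          Submodule.sub_mem _ hf (linearCombination_mem fun w hw => mem w (hc hw))
        obtain ⟨c', hc', hl, hκ⟩ := h3 t (by omega) _ hU hcl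
        refine ⟨c + c', fun i hi => ?_, fun a ha => ?_⟩
        · rcases Finset.mem_union.mp (Finsupp.support_add hi) with h | h
          · exact hc h
          · exact hc' h
        · rw [map_add, ← sub_sub]
          rcases Nat.lt_succ_iff_lt_or_eq.mp ha with h | rfl
          · rw [map_sub]
            exact Submodule.sub_mem _ (hcl a h) (low a c' hc' fun i hi => by rw [hl i hi]; exact h)
          · exact hκ
    obtain ⟨c, hc, hcl⟩ := key (A + 1) le_rfl
    refine ⟨c, hc, h4 _ ?_ fun a ha => hcl a (by omega)⟩
    exact Submodule.sub_mem _ hf (linearCombination_mem fun w hw => mem w (hc hw))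

theorem linearCombination_mapDomain_eq {W₀ : Set ι} {y : ι → V} {y₀ : ι → V''} {e : ι → ι}
    (κ : V →ₗ[K] V') (ψ : V'' →ₗ[K] V') (h : ∀ v ∈ W₀, κ (y (e v)) = ψ (y₀ v)) {c : ι →₀ K}
    (hc : (c.support : Set ι) ⊆ W₀) :
    κ (Finsupp.linearCombination K y (c.mapDomain e)) =
      ψ (Finsupp.linearCombination K y₀ c) := by
  rw [Finsupp.linearCombination_mapDomain, Finsupp.linearCombination_apply,
    Finsupp.linearCombination_apply, Finsupp.sum, Finsupp.sum, map_sum, map_sum]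
  refine Finset.sum_congr rfl fun v hv => ?_
  rw [map_smul, map_smul, Function.comp_apply, h v (hc hv)]

theorem exists_eq_mapDomain {W₀ : Set ι} {e : ι → ι} (he : Function.Injective e) {c : ι →₀ K}
    (hc : ∀ w ∈ c.support, ∃ v ∈ W₀, w = e v) :
    ∃ c₀ : ι →₀ K, (c₀.support : Set ι) ⊆ W₀ ∧ c = c₀.mapDomain e := by
  refine ⟨c.comapDomain e he.injOn, fun v hv => ?_, (Finsupp.mapDomain_comapDomain e he c ?_).symm⟩
  · have : e v ∈ c.support := by simpa using hv
    obtain ⟨v', hv', h⟩ := hc _ this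
    exact he h ▸ hv'
  · intro w hw
    obtain ⟨v, -, rfl⟩ := hc w hw
    exact ⟨v, rfl⟩

theorem exists_of_mem_support_mapDomain {W₀ : Set ι} {e : ι → ι} {c : ι →₀ K}
    (hc : (c.support : Set ι) ⊆ W₀) {w : ι} (hw : w ∈ (c.mapDomain e).support) :
    ∃ v ∈ W₀, w = e v := by
  classical
  obtain ⟨v, hv, rfl⟩ := Finset.mem_image.mp (Finsupp.mapDomain_support hw)
  exact ⟨v, hc hv, rfl⟩

end Filtration

variable {K : Type*} [Field K] [Fintype K]

/-- The truncation ideal as a subspace. -/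
def truncSub (K : Type*) [Field K] [Fintype K] (m n : ℕ) : Submodule K (MvPolynomial (Fin n) K) :=
  (truncIdeal K m n).restrictScalars K

/-- The subspace of polynomials that are invariant modulo the truncation ideal. -/
def invSub (K : Type*) [Field K] [Fintype K] (m n : ℕ) : Submodule K (MvPolynomial (Fin n) K) where
  carrier := {f | BorelInv m n f}
  add_mem' hf hg σ hσ := by
    rw [map_add, add_sub_add_comm]
    exact Ideal.add_mem _ (hf σ hσ) (hg σ hσ)
  zero_mem' σ _ := by simp
  smul_mem' c f hf σ hσ := by
    rw [map_smul, ← smul_sub, smul_eq_C_mul]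
    exact Ideal.mul_mem_left _ _ (hf σ hσ)

theorem qInt_mul_pred (q : ℕ) (hq : 1 ≤ q) (m : ℕ) : qInt q m * (q - 1) + 1 = q ^ m := by
  induction m with
  | zero => simp [qInt]
  | succ m ih =>
    have : qInt q (m + 1) = qInt q m + q ^ m := Finset.sum_range_succ _ _
    obtain ⟨p, rfl⟩ : ∃ p, q = p + 1 := ⟨q - 1, by omega⟩
    rw [this, pow_succ]
    simp only [Nat.add_sub_cancel] at ih ⊢
    rw [add_mul, add_right_comm, ih]
    ring

/-- The filtration is by the exponents a(q-1) of x_0. Levels below A = [m+1]_q are Frobenius images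
of the invariants for `m`, and level `A`, the top exponent q^{m+1} - 1, carries the invariants for m
+ 1. -/
theorem BasisMod.step {ι : Type*} {m n : ℕ} {W₀ W₁ W : Set ι} {y₀ y₁ : ι → MvPolynomial (Fin n) K}
    {y : ι → MvPolynomial (Fin (n + 1)) K}
    (H₁ : BasisMod (truncSub K (m + 1) n) (invSub K (m + 1) n) W₁ y₁)
    (H₀ : BasisMod (truncSub K m n) (invSub K m n) W₀ y₀)
    (lev : ι → ℕ) (e₁ : ι → ι) (e₀ : ℕ → ι → ι) (he₁ : Function.Injective e₁)
    (he₀ : ∀ a, Function.Injective (e₀ a))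
    (mem : ∀ w ∈ W, BorelInv (m + 1) (n + 1) (y w))
    (hW : ∀ w ∈ W, (∃ v ∈ W₁, w = e₁ v) ∨
      ∃ a < qInt (Fintype.card K) (m + 1), ∃ v ∈ W₀, w = e₀ a v)
    (hW₁ : ∀ v ∈ W₁, e₁ v ∈ W ∧ lev (e₁ v) = qInt (Fintype.card K) (m + 1))
    (hy₁ : ∀ v ∈ W₁, ∀ k, xCoeff k (y (e₁ v)) =
      if k = Fintype.card K ^ (m + 1) - 1 then y₁ v else 0)
    (hW₀ : ∀ a < qInt (Fintype.card K) (m + 1), ∀ v ∈ W₀, e₀ a v ∈ W ∧ lev (e₀ a v) = a)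
    (hy₀ : ∀ a, ∀ v ∈ W₀, xCoeff (a * (Fintype.card K - 1)) (y (e₀ a v)) = frob K n (y₀ v))
    (hy₀' : ∀ a, ∀ v ∈ W₀, ∀ k < a * (Fintype.card K - 1), xCoeff k (y (e₀ a v)) = 0) :
    BasisMod (truncSub K (m + 1) (n + 1)) (invSub K (m + 1) (n + 1)) W y := by
  set q := Fintype.card K with hq
  set A := qInt q (m + 1) with hA
  have hq1 : 2 ≤ q := Fintype.one_lt_card
  have hAq : A * (q - 1) + 1 = q ^ (m + 1) := qInt_mul_pred q (by omega) (m + 1)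
  have hAq' : A * (q - 1) = q ^ (m + 1) - 1 := by omega
  have hlt : ∀ a ≤ A, a * (q - 1) < q ^ (m + 1) := fun a ha => by
    have := Nat.mul_le_mul_right (q - 1) ha
    omega
  -- For a < A the next exponent still lies below q^{m+1}; this is the room `BorelInv.exists_frob`
  -- needs, and it fails at a = A.
  have hlt' : ∀ a < A, a * (q - 1) + (q - 1) < q ^ (m + 1) := fun a ha => by
    have := Nat.mul_le_mul_right (q - 1) (Nat.succ_le_of_lt ha)
    rw [Nat.succ_mul] at this
    omega
  have hall : ∀ f ∈ invSub K (m + 1) (n + 1), ∀ t ≤ q ^ (m + 1),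
      (∀ a, a * (q - 1) < t → xCoeff (a * (q - 1)) f ∈ truncSub K (m + 1) n) →
      ∀ k < t, xCoeff k f ∈ truncIdeal K (m + 1) n := by
    intro f hf t ht h k hk
    by_cases hd : q - 1 ∣ k
    · obtain ⟨a, rfl⟩ := hd
      rw [mul_comm] at hk ⊢
      exact h a hk
    · exact BorelInv.xCoeff_mem hf (hk.trans_le ht) hd
  have hsplit : ∀ w ∈ W, (lev w = A ∧ ∃ v ∈ W₁, w = e₁ v) ∨
      (lev w < A ∧ ∃ v ∈ W₀, w = e₀ (lev w) v) := by
    intro w hw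
    rcases hW w hw with ⟨v, hv, rfl⟩ | ⟨a, ha, v, hv, rfl⟩
    · exact Or.inl ⟨(hW₁ v hv).2, v, hv, rfl⟩
    · rw [(hW₀ a ha v hv).2]
      exact Or.inr ⟨ha, v, hv, rfl⟩
  have hκ₁ : ∀ v ∈ W₁, xCoeff (A * (q - 1)) (y (e₁ v)) = LinearMap.id (R := K) (y₁ v) := by
    intro v hv
    rw [hy₁ v hv, if_pos hAq', LinearMap.id_apply]
  refine BasisMod.of_filtration lev A (fun a => xCoeff (a * (q - 1))) (T' := truncSub K (m + 1) n)
    mem ?_ ?_ ?_ ?_ ?_ ?_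
  · intro w hw
    rcases hsplit w hw with ⟨h, -⟩ | ⟨h, -⟩ <;> omega
  · intro w hw a ha
    rcases hsplit w hw with ⟨h, v, hv, rfl⟩ | ⟨h, v, hv, hwv⟩
    · have := Nat.mul_lt_mul_of_pos_right (h ▸ ha) (show 0 < q - 1 by omega)
      rw [hy₁ v hv, if_neg (by omega)]
      exact Submodule.zero_mem _
    · rw [hwv, hy₀' _ v hv _ (Nat.mul_lt_mul_of_pos_right ha (by omega))]
      exact Submodule.zero_mem _
  · intro a ha c hc hl hmem
    rcases ha.lt_or_eq with hlt | rfl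
    · obtain ⟨c₀, hc₀, rfl⟩ := exists_eq_mapDomain (W₀ := W₀) (he₀ a) (c := c) fun w hw => by
        rcases hsplit w (hc hw) with ⟨h, -⟩ | ⟨-, h⟩
        · have := hl w hw
          omega
        · rwa [hl w hw] at h
      rw [linearCombination_mapDomain_eq _ (frob K n).toLinearMap (hy₀ a) hc₀] at hmem
      rw [H₀.indep c₀ hc₀ (frob_mem_truncIdeal_iff.mp hmem), Finsupp.mapDomain_zero]
    · obtain ⟨c₀, hc₀, rfl⟩ := exists_eq_mapDomain (W₀ := W₁) he₁ (c := c) fun w hw => by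
        rcases hsplit w (hc hw) with ⟨-, h⟩ | ⟨h, -⟩
        · exact h
        · have := hl w hw
          omega
      rw [linearCombination_mapDomain_eq _ LinearMap.id hκ₁ hc₀] at hmem
      rw [H₁.indep c₀ hc₀ hmem, Finsupp.mapDomain_zero]
  · intro a ha f hf hlow
    have hlow' : ∀ k < a * (q - 1), xCoeff k f ∈ truncIdeal K (m + 1) n :=
      hall f hf _ (hlt a ha).le fun a' ha' => hlow a' (lt_of_mul_lt_mul_right ha' (Nat.zero_le _))
    rcases ha.lt_or_eq with hlt | rfl
    · obtain ⟨g, hg, hfg⟩ := BorelInv.exists_frob hf (Dvd.intro_left _ rfl) (hlt' a hlt) hlow'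
      obtain ⟨c, hc, hgc⟩ := H₀.span g hg
      refine ⟨c.mapDomain (e₀ a), fun w hw => ?_, fun w hw => ?_, ?_⟩
      · obtain ⟨v, hv, rfl⟩ := exists_of_mem_support_mapDomain hc hw
        exact (hW₀ a hlt v hv).1
      · obtain ⟨v, hv, rfl⟩ := exists_of_mem_support_mapDomain hc hw
        exact (hW₀ a hlt v hv).2
      · rw [map_sub, linearCombination_mapDomain_eq _ (frob K n).toLinearMap (hy₀ a) hc]
        have := Ideal.add_mem _ hfg (frob_mem_truncIdeal_iff.mpr hgc)
        rwa [map_sub, sub_add_sub_cancel] at this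
    · obtain ⟨c, hc, hgc⟩ := H₁.span _ (BorelInv.xCoeff hf (hlt A le_rfl))
      refine ⟨c.mapDomain e₁, fun w hw => ?_, fun w hw => ?_, ?_⟩
      · obtain ⟨v, hv, rfl⟩ := exists_of_mem_support_mapDomain hc hw
        exact (hW₁ v hv).1
      · obtain ⟨v, hv, rfl⟩ := exists_of_mem_support_mapDomain hc hw
        exact (hW₁ v hv).2
      · rw [map_sub, linearCombination_mapDomain_eq _ LinearMap.id hκ₁ hc]
        exact hgc
  · intro f hf h
    refine mem_truncIdeal_succ_iff.mpr (hall f hf _ le_rfl fun a ha => h a ?_)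
    have ha' : a * (q - 1) < q ^ (m + 1) := ha
    exact Nat.lt_succ_iff.mp (lt_of_mul_lt_mul_right (a := q - 1) (by
      rw [Nat.succ_mul]; omega) (Nat.zero_le _))
  · intro f hf a ha
    exact mem_truncIdeal_succ_iff.mp hf _ (hlt a ha)

theorem basisMod_singleton {ι : Type*} {m n : ℕ} (h : ∀ β : Fin n →₀ ℕ,
    (∀ i, β i < Fintype.card K ^ m) → β = 0) {w : ι} {y : ι → MvPolynomial (Fin n) K}
    (hw : y w = 1) : BasisMod (truncSub K m n) (invSub K m n) {w} y := by
  refine ⟨?_, fun c hc hT => ?_, fun f _ => ⟨Finsupp.single w (coeff 0 f), ?_, ?_⟩⟩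
  · rintro w' rfl
    rw [hw]
    intro σ _
    simp
  · obtain ⟨a, rfl⟩ : ∃ a, c = Finsupp.single w a :=
      ⟨_, Finsupp.support_subset_singleton.mp (Finset.coe_subset.mp (by simpa only [Finset.coe_singleton] using hc))⟩
    rw [Finsupp.linearCombination_single, hw] at hT
    have := mem_truncIdeal_iff.mp hT 0 fun i => by simp [Fintype.card_pos]
    have ha : a = 0 := by simpa using this
    simp [ha]
  · rw [← Finset.coe_singleton]
    exact Finset.coe_subset.mpr Finsupp.support_single_subset
  · rw [Finsupp.linearCombination_single, hw]
    refine mem_truncIdeal_iff.mpr fun β hβ => ?_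
    rw [h β hβ]
    simp

end

section

section

variable {K : Type*} [Field K]

theorem toRatField_injective (n : ℕ) : Function.Injective (toRatField K n) :=
  algebraMap_ratField_injective.comp (rename_injective _ Fin.val_injective)

theorem toRatField_apply (n : ℕ) (p : MvPolynomial (Fin n) K) :
    toRatField K n p = algebraMap _ (RatField K) (rename Fin.val p) := rfl

theorem xCoeff_X_pow_mul {n : ℕ} (N k : ℕ) (f : MvPolynomial (Fin (n + 1)) K) :
    xCoeff k (X 0 ^ N * f) = if N ≤ k then xCoeff (k - N) f else 0 := by
  rw [xCoeff_apply, map_mul, map_pow, finSuccEquiv_X_zero, Polynomial.coeff_X_pow_mul']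
  rfl

theorem rename_xCoeff_zero {n : ℕ} (f : MvPolynomial (Fin (n + 1)) K) :
    rename Nat.succ (rename Fin.val (xCoeff 0 f)) = killVar 0 (rename Fin.val f) := by
  have h : ((rename Nat.succ).comp (rename Fin.val)).comp
      (((Polynomial.aeval (R := MvPolynomial (Fin n) K)
        (0 : MvPolynomial (Fin n) K)).restrictScalars K).comp (finSuccEquiv K n).toAlgHom) =
      (killVar 0).comp (rename Fin.val : _ →ₐ[K] MvPolynomial ℕ K) := by
    ext i : 1
    refine Fin.cases ?_ (fun i => ?_) i
    · simp [killVar, finSuccEquiv_X_zero]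
    · simp [killVar, finSuccEquiv_X_succ]
  rw [xCoeff_apply, Polynomial.coeff_zero_eq_eval_zero]
  exact DFunLike.congr_fun h f

end

variable {K : Type*} [Field K] [Fintype K]

/-! ### The polynomials `Y_m(I; J)` and their leading terms in the first variable -/

theorem Represents.toRatField_restr {r b n : ℕ} {f : RatField K} {p : MvPolynomial ℕ K}
    (h : Represents r b n f p) : toRatField K n (restr n p) = f := by
  rw [toRatField_apply, rename_restr, h.cutoff_eq, h.eq]

theorem exists_represents (m : ℕ) (w : List (ℕ × ℕ)) :
    ∃ p : MvPolynomial ℕ K, Represents 0 m (numVars w) (Y K m w) p := by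
  obtain ⟨p, -, h, -⟩ := exists_represents_pair (K := K) m w 0
  rw [zero_add] at h
  exact ⟨p, h⟩

/-- The expression `Y_m(I; J)` as a polynomial in `n` variables. -/
def yPoly (K : Type*) [Field K] [Fintype K] (m n : ℕ) (w : List (ℕ × ℕ)) : MvPolynomial (Fin n) K :=
  restr n (exists_represents (K := K) m w).choose

theorem represents_yPoly (m : ℕ) (w : List (ℕ × ℕ)) :
    Represents 0 m (numVars w) (Y K m w) (rename Fin.val (yPoly K m (numVars w) w)) := by
  have h := (exists_represents (K := K) m w).choose_spec
  rw [yPoly, rename_restr, h.cutoff_eq]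
  exact h

theorem toRatField_yPoly {m n : ℕ} {w : List (ℕ × ℕ)} (hw : numVars w = n) :
    toRatField K n (yPoly K m n w) = Y K m w := by
  subst hw
  exact (represents_yPoly m w).eq

theorem borelInv_yPoly {m n : ℕ} {w : List (ℕ × ℕ)} (hw : numVars w = n) :
    BorelInv m n (yPoly K m n w) := by
  subst hw
  exact (represents_yPoly m w).good.borelInv rfl

theorem D_one : D K 1 = algebraMap (MvPolynomial ℕ K) (RatField K) (X 0 ^ (Fintype.card K - 1)) := by
  have h : x K 0 ^ Fintype.card K = x K 0 ^ (Fintype.card K - 1) * x K 0 := by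
    rw [← pow_succ, Nat.sub_add_cancel Fintype.card_pos]
  simp only [D, delta, deltaMatrix, mooreMatrix, Matrix.det_fin_one, Matrix.of_apply]
  simp only [Fin.val_zero, zero_add, if_true, pow_one, map_one, mul_one, pow_zero, h]
  rw [mul_div_cancel_right₀ _ (x_ne_zero K 0), map_pow]
  rfl

theorem delta_one (b : ℕ) (f : MvPolynomial ℕ K) :
    delta K 1 b (algebraMap _ _ f) =
      algebraMap _ (RatField K) (X 0 ^ (Fintype.card K ^ b - 1) * rename Nat.succ f) := by
  have h : x K 0 ^ Fintype.card K ^ b = x K 0 ^ (Fintype.card K ^ b - 1) * x K 0 := by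
    rw [← pow_succ, Nat.sub_add_cancel (Nat.pow_pos Fintype.card_pos)]
  have hs0 : skip 0 = Nat.succ := by ext i; simp [skip]
  simp only [delta, deltaMatrix, mooreMatrix, Matrix.det_fin_one, Matrix.of_apply]
  simp only [Fin.val_zero, zero_add, if_true, pow_one, pow_zero, h, omitVar_algebraMap, hs0]
  rw [mul_right_comm, mul_div_cancel_right₀ _ (x_ne_zero K 0), map_mul, map_pow]
  rfl

theorem numVars_incHead {v : List (ℕ × ℕ)} (hv : v ≠ []) :
    numVars (incHead v) = numVars v + 1 := by
  match v, hv with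
  | (i, j) :: v, _ => simp [incHead, numVars]; omega

/-- The determinants in δ_{1;m} are 1 × 1, so the operator shifts the variables and multiplies by
x_0^{q^m-1}. -/
theorem xCoeff_yPoly_incHead {m n : ℕ} {v : List (ℕ × ℕ)} (hv0 : v ≠ []) (hv : numVars v = n)
    (k : ℕ) : xCoeff k (yPoly K m (n + 1) (incHead v)) =
      if k = Fintype.card K ^ m - 1 then yPoly K m n v else 0 := by
  have h1 : Y K m (incHead v) = delta K 1 m (Y K m v) := by
    match v, hv0 with
    | (i, j) :: w, _ => simp only [incHead, Y, Yfrom, Function.iterate_succ_apply']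
  have h2 : yPoly K m (n + 1) (incHead v) =
      X 0 ^ (Fintype.card K ^ m - 1) * rename Fin.succ (yPoly K m n v) := by
    apply toRatField_injective
    rw [toRatField_yPoly (by rw [numVars_incHead hv0, hv]), h1, ← toRatField_yPoly hv,
      toRatField_apply, delta_one, toRatField_apply, map_mul (rename _), map_pow (rename _),
      rename_X, rename_rename, rename_rename]
    rfl
  rw [h2, xCoeff_X_pow_mul, xCoeff_apply, finSuccEquiv_rename_succ, Polynomial.coeff_C]
  split_ifs <;> first | rfl | omega

/-- D_1 is x_0^{q-1}, and the cofactor is the partner polynomial of `exists_represents_pair` at rank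
0, whose value at x_0 = 0 is a q-th power. -/
theorem exists_yPoly_cons {m n : ℕ} (a : ℕ) {v : List (ℕ × ℕ)} (hv : numVars v = n) :
    ∃ Φ : MvPolynomial (Fin (n + 1)) K,
      yPoly K (m + 1) (n + 1) ((0, a) :: v) = X 0 ^ (a * (Fintype.card K - 1)) * Φ ∧
        xCoeff 0 Φ = frob K n (yPoly K m n v) := by
  subst hv
  obtain ⟨p, p', hp, hp', hpp⟩ := exists_represents_pair (K := K) m v 0
  have hpy : rename Fin.val (yPoly K m (numVars v) v) = p :=
    algebraMap_ratField_injective ((represents_yPoly m v).eq.trans hp.eq.symm)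
  rw [zero_add, add_comm 1] at hp'
  refine ⟨restr (numVars v + 1) p', toRatField_injective _ ?_, ?_⟩
  · rw [toRatField_yPoly (by simp [numVars]; omega), map_mul, hp'.toRatField_restr, map_pow]
    have : toRatField K (numVars v + 1) (X 0) =
        algebraMap (MvPolynomial ℕ K) (RatField K) (X 0) := by
      simp [toRatField_apply]
    rw [this, mul_comm a, pow_mul, ← map_pow, ← D_one]
    rfl
  · refine rename_injective _ Fin.val_injective (rename_injective _ Nat.succ_injective ?_)
    rw [rename_xCoeff_zero, rename_restr, hp'.cutoff_eq, hpp, frob_apply, map_pow, map_pow, hpy]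

theorem xCoeff_yPoly_cons {m n : ℕ} (a : ℕ) {v : List (ℕ × ℕ)} (hv : numVars v = n) :
    xCoeff (a * (Fintype.card K - 1)) (yPoly K (m + 1) (n + 1) ((0, a) :: v)) =
      frob K n (yPoly K m n v) := by
  obtain ⟨Φ, h1, h2⟩ := exists_yPoly_cons (K := K) (m := m) a hv
  rw [h1, xCoeff_X_pow_mul, if_pos le_rfl, Nat.sub_self, h2]

theorem xCoeff_yPoly_cons_eq_zero {m n : ℕ} (a : ℕ) {v : List (ℕ × ℕ)} (hv : numVars v = n) {k : ℕ}
    (hk : k < a * (Fintype.card K - 1)) :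
    xCoeff k (yPoly K (m + 1) (n + 1) ((0, a) :: v)) = 0 := by
  obtain ⟨Φ, h1, -⟩ := exists_yPoly_cons (K := K) (m := m) a hv
  rw [h1, xCoeff_X_pow_mul, if_neg (not_le.mpr hk)]

theorem yPoly_eq_one {m n : ℕ} {w : List (ℕ × ℕ)} (hw : numVars w = n) (h : Y K m w = 1) :
    yPoly K m n w = 1 :=
  toRatField_injective n (by rw [toRatField_yPoly hw, h, map_one])

/-- The exponent of `D_1` in the leading term of an element of `𝓑_m(n)`, where `A = [m]_q`. -/
def level (A : ℕ) : List (ℕ × ℕ) → ℕ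
  | [] => 0
  | (0, a) :: _ => a
  | (_ + 1, _) :: _ => A

/-! ### Induction on the number of variables. -/

theorem incHead_injective : Function.Injective incHead := by
  intro v w h
  match v, w with
  | [], [] => rfl
  | [], _ :: _ => simp [incHead] at h
  | _ :: _, [] => simp [incHead] at h
  | (i, j) :: v, (i', j') :: w => simpa [incHead] using h

/-- With no variables the ring is 𝔽_q, with basis the empty expression. As `words` is empty there,
the singleton takes its place at the start of the induction. -/
theorem basisMod_yPoly_nil (m : ℕ) :
    BasisMod (truncSub K m 0) (invSub K m 0) {[]} (yPoly K m 0) :=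
  basisMod_singleton (fun β _ => by ext i; exact i.elim0) (yPoly_eq_one rfl rfl)

theorem basisMod_yPoly_zero (n : ℕ) :
    BasisMod (truncSub K 0 (n + 1)) (invSub K 0 (n + 1)) (words (Fintype.card K) 0 (n + 1))
      (yPoly K 0 (n + 1)) := by
  have hw : words (Fintype.card K) 0 (n + 1) = {[(n, 0)]} := by simp [words]
  have hY : Y K 0 [(n, 0)] = 1 := by
    have : Y K 0 [(n, 0)] ∈ basisSet K 0 (n + 1) := ⟨_, by rw [hw]; rfl, rfl⟩
    rwa [basisSet_zero] at this
  rw [hw]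
  exact basisMod_singleton (fun β h => Finsupp.ext fun i => by simpa using h i)
    (yPoly_eq_one (by simp [numVars]) hY)

theorem basisMod_yPoly (m n : ℕ) :
    BasisMod (truncSub K m (n + 1)) (invSub K m (n + 1)) (words (Fintype.card K) m (n + 1))
      (yPoly K m (n + 1)) := by
  induction n generalizing m with
  | zero =>
    match m with
    | 0 => exact basisMod_yPoly_zero 0
    | m + 1 =>
      -- One variable is a step from none. The top power of D_1 plays the part of the δ_{1;m} half,
      -- and since all words start with a zero the argument of `level` is immaterial.
      refine BasisMod.step (basisMod_yPoly_nil (m + 1)) (basisMod_yPoly_nil m) (level 0)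
        (fun v => (0, qInt (Fintype.card K) (m + 1)) :: v) (fun a v => (0, a) :: v)
        (fun v w h => List.tail_eq_of_cons_eq h) (fun a v w h => List.tail_eq_of_cons_eq h)
        (fun w hw => borelInv_yPoly (numVars_of_mem_words _ _ _ w hw)) ?_ ?_ ?_ ?_ ?_ ?_
      · rintro w ⟨a, ha, rfl⟩
        rcases ha.lt_or_eq with h | rfl
        · exact Or.inr ⟨a, h, [], rfl, rfl⟩
        · exact Or.inl ⟨[], rfl, rfl⟩
      · rintro v rfl
        exact ⟨⟨_, le_rfl, rfl⟩, rfl⟩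
      · rintro v rfl k
        have hA := qInt_mul_pred (Fintype.card K) Fintype.card_pos (m + 1)
        have hY : yPoly K (m + 1) 1 [(0, qInt (Fintype.card K) (m + 1))] =
            X 0 ^ (qInt (Fintype.card K) (m + 1) * (Fintype.card K - 1)) * rename Fin.succ 1 := by
          apply toRatField_injective
          rw [toRatField_yPoly (by simp [numVars]), map_one, mul_one, toRatField_apply, map_pow (rename _),
            rename_X, mul_comm, pow_mul, map_pow, Fin.val_zero, ← D_one]
          simp [Y, Yfrom]
        rw [hY, xCoeff_X_pow_mul, xCoeff_apply, finSuccEquiv_rename_succ, Polynomial.coeff_C,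
          yPoly_eq_one (n := 0) (w := []) rfl rfl]
        split_ifs <;> first | rfl | omega
      · rintro a ha v rfl
        exact ⟨⟨a, ha.le, rfl⟩, rfl⟩
      · rintro a v rfl
        exact xCoeff_yPoly_cons (m := m) (n := 0) (v := []) a rfl
      · rintro a v rfl k hk
        exact xCoeff_yPoly_cons_eq_zero (m := m) (n := 0) (v := []) a rfl hk
  | succ n ih =>
    match m with
    | 0 => exact basisMod_yPoly_zero (n + 1)
    | m + 1 =>
      refine BasisMod.step (ih (m + 1)) (ih m) (level (qInt (Fintype.card K) (m + 1)))
        incHead (fun a v => (0, a) :: v)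
        incHead_injective (fun a v w h => List.tail_eq_of_cons_eq h)
        (fun w hw => borelInv_yPoly (numVars_of_mem_words _ _ _ w hw)) ?_ ?_ ?_ ?_ ?_ ?_
      · rintro w (⟨v, hv, rfl⟩ | ⟨a, ha, v, hv, rfl⟩)
        · exact Or.inl ⟨v, hv, rfl⟩
        · exact Or.inr ⟨a, ha, v, hv, rfl⟩
      · intro v hv
        refine ⟨Or.inl ⟨v, hv, rfl⟩, ?_⟩
        have := words_ne_nil _ _ _ v hv
        match v, this with
        | (i, j) :: v, _ => rfl
      · intro v hv k
        exact xCoeff_yPoly_incHead (words_ne_nil _ _ _ v hv) (numVars_of_mem_words _ _ _ v hv) k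
      · exact fun a ha v hv => ⟨Or.inr ⟨a, ha, v, hv, rfl⟩, rfl⟩
      · exact fun a v hv => xCoeff_yPoly_cons a (numVars_of_mem_words _ _ _ v hv)
      · exact fun a v hv k hk =>
          xCoeff_yPoly_cons_eq_zero a (numVars_of_mem_words _ _ _ v hv) hk

/-! ### Passage to the quotient ring. -/

theorem mk_mem_invariants_iff {m n : ℕ} (f : MvPolynomial (Fin n) K) :
    Ideal.Quotient.mk (truncIdeal K m n) f ∈ invariants K m n ↔ f ∈ invSub K m n :=
  forall₂_congr fun _ _ => Ideal.Quotient.eq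

/-- Two words with the same value give the relation y_v - y_w = 0, which independence forbids unless
v = w. -/
theorem injOn_Y {m n : ℕ} (hn : 1 ≤ n) :
    Set.InjOn (Y K m) (words (Fintype.card K) m n) := by
  obtain ⟨n, rfl⟩ : ∃ k, n = k + 1 := ⟨n - 1, by omega⟩
  intro v hv w hw h
  have hp : yPoly K m (n + 1) v = yPoly K m (n + 1) w := toRatField_injective _ (by
    rw [toRatField_yPoly (numVars_of_mem_words _ _ _ v hv),
      toRatField_yPoly (numVars_of_mem_words _ _ _ w hw), h])
  have h0 := (basisMod_yPoly (K := K) m n).indep (Finsupp.single v 1 - Finsupp.single w 1) ?_ ?_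
  · exact Finsupp.single_left_injective one_ne_zero (sub_eq_zero.mp h0)
  · classical
    intro u hu
    rcases Finset.mem_union.mp (Finsupp.support_sub hu) with h' | h'
    · rwa [Finset.mem_singleton.mp (Finsupp.support_single_subset h')]
    · rwa [Finset.mem_singleton.mp (Finsupp.support_single_subset h')]
  · simp [hp]

theorem exists_basis_invariants {m n : ℕ} (hn : 1 ≤ n) :
    ∃ β : Module.Basis (basisSet K m n) K (invariants K m n),
      ∀ f : basisSet K m n, ∃ p : MvPolynomial (Fin n) K,
        toRatField K n p = f ∧ (β f : Trunc K m n) = Ideal.Quotient.mk (truncIdeal K m n) p := by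
  have hinj := injOn_Y (K := K) (m := m) hn
  obtain ⟨n, rfl⟩ : ∃ k, n = k + 1 := ⟨n - 1, by omega⟩
  have H := basisMod_yPoly (K := K) m n
  have hpre : ∀ f : basisSet K m (n + 1), ∃ w ∈ words (Fintype.card K) m (n + 1), Y K m w = f :=
    fun f => f.2
  choose e he heY using hpre
  have e_inj : Function.Injective e := fun f g h => Subtype.ext (by rw [← heY, h, heY])
  have he_eq : ∀ w (hw : w ∈ words (Fintype.card K) m (n + 1)),
      e ⟨Y K m w, w, hw, rfl⟩ = w := fun w hw => hinj (he _) hw (heY _)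
  let π : MvPolynomial (Fin (n + 1)) K →ₗ[K] Trunc K m (n + 1) :=
    (Ideal.Quotient.mkₐ K (truncIdeal K m (n + 1))).toLinearMap
  have hπ : ∀ f, π f = 0 ↔ f ∈ truncIdeal K m (n + 1) := fun f => Ideal.Quotient.eq_zero_iff_mem
  let b : basisSet K m (n + 1) → invariants K m (n + 1) := fun f =>
    ⟨π (yPoly K m (n + 1) (e f)), (mk_mem_invariants_iff _).mpr (H.mem _ (he f))⟩
  -- The basis is indexed by rational functions, the family `yPoly` by words; the injection `e`
  -- transports coefficients from the former to the latter.
  have hlin : LinearIndependent K ((invariants K m (n + 1)).subtype ∘ b) := by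
    rw [linearIndependent_iff]
    intro l hl
    have h1 : π (Finsupp.linearCombination K (yPoly K m (n + 1)) (l.mapDomain e)) = 0 := by
      rw [← hl, Finsupp.linearCombination_mapDomain, Finsupp.apply_linearCombination]
      rfl
    refine Finsupp.mapDomain_injective e_inj ?_
    rw [Finsupp.mapDomain_zero]
    refine H.indep _ (fun w hw => ?_) ((hπ _).mp h1)
    classical
    obtain ⟨f, -, rfl⟩ := Finset.mem_image.mp (Finsupp.mapDomain_support hw)
    exact he f
  have hspan : ⊤ ≤ Submodule.span K (Set.range b) := by
    rintro ⟨F, hF⟩ -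
    obtain ⟨f, rfl⟩ := Ideal.Quotient.mk_surjective F
    obtain ⟨c, hc, hcf⟩ := H.span f ((mk_mem_invariants_iff f).mp hF)
    have h1 : π f = π (Finsupp.linearCombination K (yPoly K m (n + 1)) c) := by
      rw [← sub_eq_zero, ← map_sub]
      exact (hπ _).mpr hcf
    have h2 : π f ∈ (Submodule.span K (Set.range b)).map (invariants K m (n + 1)).subtype := by
      rw [h1]
      refine linearCombination_mem (U := ((Submodule.span K (Set.range b)).map
        (invariants K m (n + 1)).subtype).comap π) fun w hw => ?_
      exact ⟨b ⟨Y K m w, w, hc hw, rfl⟩, Submodule.subset_span ⟨_, rfl⟩, by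
        simp only [b, he_eq w (hc hw)]; rfl⟩
    obtain ⟨z, hz, hzf⟩ := h2
    have : z = ⟨_, hF⟩ := Subtype.ext hzf
    rwa [this] at hz
  refine ⟨Module.Basis.mk (LinearIndependent.of_comp _ hlin) hspan, fun f =>
    ⟨yPoly K m (n + 1) (e f), ?_, ?_⟩⟩
  · rw [toRatField_yPoly (numVars_of_mem_words _ _ _ _ (he f)), heY]
  · rw [Module.Basis.mk_apply]
    rfl

end

end Borel

end

theorem theorem1p1 (K : Type*) [Field K] [Fintype K] (m n : ℕ) (hn : 1 ≤ n) :
    Set.InjOn (Borel.Y K m) (Borel.words (Fintype.card K) m n) ∧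
    ∃ β : Module.Basis (Borel.basisSet K m n) K (Borel.invariants K m n),
      ∀ f : Borel.basisSet K m n, ∃ p : MvPolynomial (Fin n) K,
        Borel.toRatField K n p = f ∧
          (β f : Borel.Trunc K m n) = Ideal.Quotient.mk (Borel.truncIdeal K m n) p :=
  ⟨Borel.injOn_Y hn, Borel.exists_basis_invariants hn⟩
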